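/- Let $w$ be an integrable function on $[-1,1]$ with $w(x)>0$ almost everywhere, let $t_1,t_2,t_3,\ldots$ be distinct numbers in $(-1,1)$, and let $b_k(x)=\frac1{1+t_kx}$ for $k\ge 1$. For $n\ge1$, nodes $x_1<\dots<x_n$ in $[-1,1]$ and real weights $\beta_1,\dots,\beta_n$, the quadrature formula $\int_{-1}^1 f(x)w(x)\,dx\approx\sum_{j=1}^n\beta_jf(x_j)$ is called * *orthogonal quadrature* with $n$ nodes if $x_1,\dots,x_n$ are precisely the zeros in $[-1,1]$ of the function $r_{n+1}$, where $r_1,r_2,\ldots$ are obtained from $b_1,b_2,\dots$ by the Gram–Schmidt procedure for the inner product $(f,g)=\int_{-1}^1 f(x)g(x)w(x)\,dx$, and the formula is interpolatory, that is, exact for $b_1,\dots,b_n$; * *Gaussian quadrature* with $n$ nodes if it is exact for $b_1,\dots,b_{2n}$. Let $E_n^of$ and $E_n^gf$ denote the error $\int_{-1}^1 f(x)w(x)\,dx-\sum_{j=1}^n\beta_jf(x_j)$ of orthogonal and Gaussian quadrature with $n$ nodes, respectively. For $f\in C[-1,1]$ let $\phi_m$ be the best uniform approximation of $f$ on $[-1,1]$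 by linear combinations of $b_1,\dots,b_m$, and let $\|\cdot\|_\infty$ be the uniform norm on $[-1,1]$. Consider the density condition $$\sum_{k=1}^\infty(1-|c_k|)=\infty,\qquad\text{where } |c_k|<1,\quad c_k+\frac1{c_k}=-\frac2{t_k}\ \text{ if } t_k\ne0,\qquad c_k=0\ \text{ if } t_k=0. \tag{4.1}$$ 1. If $t_1=0$, then orthogonal quadrature exists for every $n\ge1$, and there is a constant $M>0$, not depending on $n$ or $f$, such that $|E_n^of|\le M\|f-\phi_{n+1}\|_\infty$ for all $n\ge1$ and all $f\in C[-1,1]$. Moreover, if (4.1) holds, then $E_n^of\to0$ as $n\to\infty$ for every bounded Riemann integrable function $f$ on $[-1,1]$. 2. (Without assuming $t_1=0$.) Gaussian quadrature exists for every $n\ge1$, and there is a constant $M>0$, not depending on $n$ or $f$, such that $|E_n^gf|\le M\|f-\phi_{2n}\|_\infty$ for all $n\ge1$ and all $f\in C[-1,1]$. Moreover, if (4.1) holds, then $E_n^gf\to0$ as $n\to\infty$ for every bounded Riemann integrable function $f$ on $[-1,1]$. -/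

import Mathlib

namespace RationalQuadrature

/-- The basis functions `1 / (1 + t_k x)`. The parameters are indexed from `0`,
so that `t 0, t 1, …` are `t_1, t_2, …` of the usual numbering. -/
noncomputable def basisFn (t : ℕ → ℝ) (k : ℕ) (x : ℝ) : ℝ := 1 / (1 + t k * x)

/-- The inner product `(f, g) = ∫_{-1}^1 f g w`. -/
noncomputable def ip (w f g : ℝ → ℝ) : ℝ := ∫ x in (-1 : ℝ)..1, f x * g x * w x

/-- Gram-Schmidt applied to the basis functions. `orthFn w t n` is the `(n+1)`-st orthogonal
function: `1 / (1 + t_{n+1} x)` minus its projection on the span of the previous ones. -/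
noncomputable def orthFn (w : ℝ → ℝ) (t : ℕ → ℝ) (n : ℕ) : ℝ → ℝ := fun x =>
  basisFn t n x - ∑ i : Fin n,
    ip w (basisFn t n) (orthFn w t i) / ip w (orthFn w t i) (orthFn w t i) * orthFn w t i x
termination_by n
decreasing_by all_goals exact i.isLt

/-- The formula `∑ j, β j * g (x j)` integrates the first `m` basis functions correctly. -/
def ExactOn (w : ℝ → ℝ) (t : ℕ → ℝ) (m : ℕ) {n : ℕ} (x β : Fin n → ℝ) : Prop :=
  ∀ k < m, ∫ y in (-1 : ℝ)..1, basisFn t k y * w y = ∑ j, β j * basisFn t k (x j)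

/-- Orthogonal quadrature with `n` nodes: the nodes, in increasing order, are precisely the zeros
in `[-1, 1]` of the `(n+1)`-st orthogonal function, and the formula is the interpolatory one,
i.e. it integrates the first `n` basis functions correctly. -/
structure IsOrthogonalQuadrature (w : ℝ → ℝ) (t : ℕ → ℝ) (n : ℕ) (x β : Fin n → ℝ) : Prop where
  strictMono : StrictMono x
  range_eq : Set.range x = {y | y ∈ Set.Icc (-1 : ℝ) 1 ∧ orthFn w t n y = 0}
  exactOn : ExactOn w t n x β

/-- Gaussian quadrature with `n` nodes: `n` different nodes in `[-1, 1]`, in increasing order,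
and weights such that the first `2n` basis functions are integrated correctly. -/
structure IsGaussianQuadrature (w : ℝ → ℝ) (t : ℕ → ℝ) (n : ℕ) (x β : Fin n → ℝ) : Prop where
  strictMono : StrictMono x
  mem_Icc : ∀ j, x j ∈ Set.Icc (-1 : ℝ) 1
  exactOn : ExactOn w t (2 * n) x β

/-- The error `∫_{-1}^1 f w - ∑ j, β j * f (x j)` of a quadrature formula. -/
noncomputable def quadError (w f : ℝ → ℝ) {n : ℕ} (x β : Fin n → ℝ) : ℝ :=
  (∫ y in (-1 : ℝ)..1, f y * w y) - ∑ j, β j * f (x j)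

/-- The uniform norm on `[-1, 1]` (of a function that is bounded there). -/
noncomputable def supNorm (g : ℝ → ℝ) : ℝ := ⨆ x : Set.Icc (-1 : ℝ) 1, |g x|

/-- `φ` is a best uniform approximation of `f` on `[-1, 1]` among the linear combinations of the
first `m` basis functions. -/
def IsBestApprox (t : ℕ → ℝ) (m : ℕ) (f φ : ℝ → ℝ) : Prop :=
  φ ∈ Submodule.span ℝ (Set.range fun k : Fin m => basisFn t k) ∧
    ∀ ψ ∈ Submodule.span ℝ (Set.range fun k : Fin m => basisFn t k),
      supNorm (f - φ) ≤ supNorm (f - ψ)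

/-- `f` is bounded and Riemann (Darboux) integrable on `[-1, 1]`: there are partitions
`-1 = p_0 ≤ p_1 ≤ … ≤ p_N = 1` whose upper and lower sums are arbitrarily close. -/
def IsBoundedRiemannIntegrable (f : ℝ → ℝ) : Prop :=
  (∃ C : ℝ, ∀ x ∈ Set.Icc (-1 : ℝ) 1, |f x| ≤ C) ∧
    ∀ ε > 0, ∃ (N : ℕ) (p : ℕ → ℝ), Monotone p ∧ p 0 = -1 ∧ p N = 1 ∧
      ∑ i ∈ Finset.range N,
        (sSup (f '' Set.Icc (p i) (p (i + 1))) - sInf (f '' Set.Icc (p i) (p (i + 1)))) *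
          (p (i + 1) - p i) < ε

/-- The number `c` with `|c| < 1` and `c + 1 / c = -2 / t`, that is,
`c = -1 / t - √(1 / t ^ 2 - 1)` with the branch of the square root for which `|c| < 1`
(and `c = 0` for `t = 0`). -/
noncomputable def joukowskiParam (t : ℝ) : ℝ := -t / (1 + √(1 - t ^ 2))

theorem joukowskiParam_spec {t : ℝ} (ht : t ∈ Set.Ioo (-1 : ℝ) 1) (h0 : t ≠ 0) :
    |joukowskiParam t| < 1 ∧ joukowskiParam t + 1 / joukowskiParam t = -2 / t := by
  have h1 : 0 < 1 - t ^ 2 := by nlinarith [ht.1, ht.2]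
  have hs : 0 < √(1 - t ^ 2) := Real.sqrt_pos.2 h1
  have hq : √(1 - t ^ 2) ^ 2 = 1 - t ^ 2 := Real.sq_sqrt h1.le
  have hd : 0 < 1 + √(1 - t ^ 2) := by linarith
  unfold joukowskiParam
  constructor
  · rw [abs_div, abs_neg, abs_of_pos hd, div_lt_one hd]
    have : |t| < 1 := abs_lt.2 ht
    linarith
  · field_simp
    linear_combination -hq

/-- The density condition `∑ (1 - |c_k|) = ∞`. -/
def DensityCondition (t : ℕ → ℝ) : Prop :=
  Filter.Tendsto (fun n => ∑ k ∈ Finset.range n, (1 - |joukowskiParam (t k)|))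
    Filter.atTop Filter.atTop

end RationalQuadrature

/-!
The idea is to reduce both kinds of quadrature to classical Gaussian quadrature for a modified
weight. On `[-1, 1]`, the linear combinations of the first `m` basis functions are the fractions
`p / q_m` with `deg p < m`, where `q_m = ∏_{k < m} (1 + t_k X)` is positive (`denom`); all indices
start from `0`. Hence Gaussian quadrature for `w` is polynomial Gaussian quadrature for the weight
`w / q_{2n}`. The numerator of the orthogonal function `orthFn w t n` is an orthogonal polynomial of
degree `n` for the weight `w / (q_n q_{n+1})` (`orthFn_numerator`), and as `q_{n+1}` has degree at
most `n` when `t_0 = 0`, the interpolatory formula on its zeros is again exact for all polynomials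
of degree less than `2n` with respect to that weight (`IsWeight.exact_of_orthogonal`,
`IsOrthogonalQuadrature.exact`). In both cases the nodes are real and simple, since an orthogonal
polynomial changes sign `n` times (`IsWeight.exists_zeros`), and the weights are nonnegative, by
integrating squares (`IsWeight.weights_nonneg`). Orthogonal quadrature with `n` nodes is even exact
for the first `n + 1` basis functions.

The weights sum up to at most `2 ∫ b_0 w`, because the formulas are exact for `b_0 ≥ 1/2`. This
gives the error bound, with a constant independent of `n`.

For convergence, the basis functions have to be dense in `C[-1, 1]` under the density condition. By
a partial fraction decomposition of the Chebyshev–Markov rational functions, which are bounded by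
`1` on `[-1, 1]` but large at a point outside, one further function `1 / (1 + s x)` belongs to the
closed span (`exists_approx_of_density`). The product of this function and a basis function is a
linear combination of the two, so it multiplies the closed span into itself, and the
Stone–Weierstrass theorem applies to the algebra of multipliers (`topologicalClosure_fullSpan`).
Finally, a Riemann integrable function is squeezed between its Lipschitz envelopes, whose gap tends
to zero almost everywhere (`IsBoundedRiemannIntegrable.ae_tendsto_envelopeGap`); the weights being
nonnegative, the formulas converge for it as well.
-/

namespace RationalQuadrature

/-! ### Linear combinations of the basis functions as rational functions -/

section RationalFunctions

open Polynomial

theorem one_add_mul_pos {s x : ℝ} (hs : s ∈ Set.Ioo (-1 : ℝ) 1) (hx : x ∈ Set.Icc (-1 : ℝ) 1) :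
    0 < 1 + s * x := by
  have h1 : |s * x| < 1 := by
    rw [abs_mul]
    have := abs_lt.2 hs
    have := abs_le.2 hx
    nlinarith [abs_nonneg s, abs_nonneg x]
  linarith [(abs_lt.1 h1).1]

/-- The common denominator `∏_{k < m} (1 + t_k X)` of the first `m` basis functions. -/
noncomputable def denom (t : ℕ → ℝ) (m : ℕ) : ℝ[X] :=
  ∏ k ∈ Finset.range m, (1 + C (t k) * X)

theorem denom_zero (t : ℕ → ℝ) : denom t 0 = 1 := by simp [denom]

theorem denom_succ (t : ℕ → ℝ) (m : ℕ) : denom t (m + 1) = denom t m * (1 + C (t m) * X) :=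
  Finset.prod_range_succ _ _

theorem eval_denom (t : ℕ → ℝ) (m : ℕ) (x : ℝ) :
    (denom t m).eval x = ∏ k ∈ Finset.range m, (1 + t k * x) := by
  simp [denom, eval_prod]

theorem denom_pos {t : ℕ → ℝ} (ht : ∀ k, t k ∈ Set.Ioo (-1 : ℝ) 1) (m : ℕ) {x : ℝ}
    (hx : x ∈ Set.Icc (-1 : ℝ) 1) : 0 < (denom t m).eval x := by
  rw [eval_denom]
  exact Finset.prod_pos fun k _ => one_add_mul_pos (ht k) hx

theorem degree_linear_le (s : ℝ) : (1 + C s * X : ℝ[X]).degree ≤ 1 := by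
  compute_degree

theorem degree_denom_le (t : ℕ → ℝ) (m : ℕ) : (denom t m).degree ≤ m := by
  induction m with
  | zero => simp [denom_zero]
  | succ m ih =>
    rw [denom_succ, Nat.cast_succ]
    exact (degree_mul_le _ _).trans (add_le_add ih (degree_linear_le _))

theorem coeff_denom (t : ℕ → ℝ) (m : ℕ) : (denom t m).coeff m = ∏ k ∈ Finset.range m, t k := by
  induction m with
  | zero => simp [denom_zero]
  | succ m ih =>
    have h : (denom t m).coeff (m + 1) = 0 :=
      coeff_eq_zero_of_degree_lt ((degree_denom_le t m).trans_lt (by exact_mod_cast m.lt_succ_self))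
    rw [denom_succ, mul_add, mul_one, coeff_add, h, ← mul_assoc, coeff_mul_X, coeff_mul_C, ih,
      Finset.prod_range_succ, zero_add]

/-- If `1 + s X` has a root `-1 / s`, it is not a root of `denom t m`. -/
theorem eval_denom_ne_zero {t : ℕ → ℝ} {m : ℕ} {s : ℝ} (hs : ∀ k < m, s ≠ t k) (h0 : s ≠ 0) :
    (denom t m).eval (-1 / s) ≠ 0 := by
  rw [eval_denom, Finset.prod_ne_zero_iff]
  intro k hk h
  apply hs k (Finset.mem_range.1 hk)
  field_simp at h
  linarith

/-- One step of the partial fraction decomposition: dividing by `denom t m * (1 + s X)`, it says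
that `p / (denom t m * (1 + s X))` is a multiple of `1 / (1 + s X)` plus a proper fraction with
denominator `denom t m`. -/
theorem exists_split {t : ℕ → ℝ} {m : ℕ} {s : ℝ} (hs : ∀ k < m, s ≠ t k) {p : ℝ[X]}
    (hp : p.degree < (m + 1 : ℕ)) :
    ∃ (a : ℝ) (r : ℝ[X]), r.degree < (m : ℕ) ∧ p = C a * denom t m + (1 + C s * X) * r := by
  by_cases h0 : s = 0
  · subst h0
    have hc : (denom t m).coeff m ≠ 0 := by
      rw [coeff_denom, Finset.prod_ne_zero_iff]
      exact fun k hk => (hs k (Finset.mem_range.1 hk)).symm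
    refine ⟨p.coeff m / (denom t m).coeff m,
      p - C (p.coeff m / (denom t m).coeff m) * denom t m, ?_, by simp⟩
    rw [degree_lt_iff_coeff_zero]
    intro k hk
    rcases hk.eq_or_lt with rfl | hk
    · simp [hc]
    · have h1 : p.coeff k = 0 := coeff_eq_zero_of_degree_lt
        (hp.trans_le (by exact_mod_cast hk))
      have h2 : (denom t m).coeff k = 0 := coeff_eq_zero_of_degree_lt
        ((degree_denom_le t m).trans_lt (by exact_mod_cast hk))
      simp [h1, h2]
  · have hd := eval_denom_ne_zero hs h0
    set a := p.eval (-1 / s) / (denom t m).eval (-1 / s) with ha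
    have hroot : (p - C a * denom t m).IsRoot (-1 / s) := by
      simp [IsRoot, ha, hd]
    obtain ⟨r, hr⟩ := dvd_iff_isRoot.2 hroot
    have hlin : (X - C (-1 / s) : ℝ[X]) = C (1 / s) * (1 + C s * X) := by
      have : C (1 / s) * C s = (1 : ℝ[X]) := by rw [← C_mul]; simp [h0]
      rw [mul_add, ← mul_assoc, this, neg_div, C_neg]; ring
    refine ⟨a, C (1 / s) * r, ?_, ?_⟩
    · have h1 : (p - C a * denom t m).degree < (m + 1 : ℕ) := by
        refine (degree_sub_le _ _).trans_lt (max_lt hp ?_)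
        refine (degree_mul_le _ _).trans_lt ?_
        refine (add_le_add degree_C_le (degree_denom_le t m)).trans_lt ?_
        rw [zero_add]; exact_mod_cast m.lt_succ_self
      have h2 : (C (1 / s) * r).degree = r.degree := degree_C_mul (by simpa using h0)
      rw [h2]
      by_cases hr0 : r = 0
      · rw [hr0, degree_zero]; exact WithBot.bot_lt_coe m
      rw [hr, degree_mul, degree_X_sub_C, degree_eq_natDegree hr0] at h1
      rw [degree_eq_natDegree hr0]
      have h3 : 1 + r.natDegree < m + 1 := by exact_mod_cast h1
      exact_mod_cast (by omega : r.natDegree < m)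
    · rw [hlin] at hr
      linear_combination hr

/-- The span of the first `m` basis functions. -/
abbrev basisSpan (t : ℕ → ℝ) (m : ℕ) : Submodule ℝ (ℝ → ℝ) :=
  Submodule.span ℝ (Set.range fun k : Fin m => basisFn t k)

theorem basisFn_mem_basisSpan (t : ℕ → ℝ) {k m : ℕ} (h : k < m) : basisFn t k ∈ basisSpan t m :=
  Submodule.subset_span ⟨⟨k, h⟩, rfl⟩

theorem basisSpan_mono (t : ℕ → ℝ) {m m' : ℕ} (h : m ≤ m') : basisSpan t m ≤ basisSpan t m' := by
  refine Submodule.span_le.2 ?_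
  rintro _ ⟨k, rfl⟩
  exact basisFn_mem_basisSpan t (k.2.trans_le h)

theorem exists_mem_basisSpan_eq_div {t : ℕ → ℝ} (ht : ∀ k, t k ∈ Set.Ioo (-1 : ℝ) 1)
    (hinj : Function.Injective t) (m : ℕ) {p : ℝ[X]} (hp : p.degree < (m : ℕ)) :
    ∃ φ ∈ basisSpan t m, ∀ x ∈ Set.Icc (-1 : ℝ) 1, φ x = p.eval x / (denom t m).eval x := by
  induction m generalizing p with
  | zero =>
    refine ⟨0, Submodule.zero_mem _, fun x _ => ?_⟩
    have : p = 0 := by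
      rw [← degree_eq_bot]
      simpa using hp
    simp [this]
  | succ m ih =>
    obtain ⟨a, r, hr, hpr⟩ := exists_split (t := t) (s := t m)
      (fun k hk h => hk.ne' (hinj h)) hp
    obtain ⟨φ, hφ, hφe⟩ := ih hr
    refine ⟨a • basisFn t m + φ, Submodule.add_mem _
      (Submodule.smul_mem _ _ (basisFn_mem_basisSpan t m.lt_succ_self))
      (basisSpan_mono t m.le_succ hφ), fun x hx => ?_⟩
    have h1 := (denom_pos ht m hx).ne'
    have h2 := (one_add_mul_pos (ht m) hx).ne'
    rw [Pi.add_apply, Pi.smul_apply, hφe x hx, hpr, denom_succ, basisFn]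
    simp only [eval_add, eval_mul, eval_C, eval_one, eval_X, smul_eq_mul]
    field_simp

theorem exists_eq_div_of_mem_basisSpan {t : ℕ → ℝ} (ht : ∀ k, t k ∈ Set.Ioo (-1 : ℝ) 1)
    {m : ℕ} {φ : ℝ → ℝ} (hφ : φ ∈ basisSpan t m) :
    ∃ p : ℝ[X], p.degree < (m : ℕ) ∧
      ∀ x ∈ Set.Icc (-1 : ℝ) 1, φ x = p.eval x / (denom t m).eval x := by
  induction hφ using Submodule.span_induction with
  | mem φ h =>
    obtain ⟨k, rfl⟩ := h
    refine ⟨∏ j ∈ (Finset.range m).erase k, (1 + C (t j) * X), ?_, fun x hx => ?_⟩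
    · have h1 : (∏ j ∈ (Finset.range m).erase k, (1 + C (t j) * X : ℝ[X])).degree
          ≤ ∑ j ∈ (Finset.range m).erase k, (1 : WithBot ℕ) :=
        (degree_prod_le _ _).trans (Finset.sum_le_sum fun j _ => degree_linear_le _)
      have hk := k.2
      refine h1.trans_lt ?_
      rw [Finset.sum_const, Finset.card_erase_of_mem (Finset.mem_range.2 hk), Finset.card_range,
        nsmul_eq_mul, mul_one]
      exact_mod_cast (by omega : m - 1 < m)
    · have h1 := (one_add_mul_pos (ht k) hx).ne'
      have h2 := (denom_pos ht m hx).ne'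
      rw [eq_div_iff h2, eval_denom, ← Finset.mul_prod_erase _ _ (Finset.mem_range.2 k.2),
        eval_prod]
      simp only [eval_add, eval_mul, eval_C, eval_one, eval_X, basisFn]
      field_simp
  | zero => exact ⟨0, by rw [degree_zero]; exact WithBot.bot_lt_coe m, by simp⟩
  | add φ ψ _ _ h1 h2 =>
    obtain ⟨p, hp, hpe⟩ := h1
    obtain ⟨q, hq, hqe⟩ := h2
    refine ⟨p + q, (degree_add_le _ _).trans_lt (max_lt hp hq), fun x hx => ?_⟩
    rw [Pi.add_apply, hpe x hx, hqe x hx, eval_add, add_div]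
  | smul a φ _ h =>
    obtain ⟨p, hp, hpe⟩ := h
    refine ⟨C a * p, ?_, fun x hx => ?_⟩
    · rw [← smul_eq_C_mul]; exact (degree_smul_le a p).trans_lt hp
    · rw [Pi.smul_apply, hpe x hx, eval_mul, eval_C, smul_eq_mul, mul_div_assoc]

theorem eq_zero_of_eval_eq_zero_on {p : ℝ[X]} (h : ∀ x ∈ Set.Icc (-1 : ℝ) 1, p.eval x = 0) :
    p = 0 :=
  eq_zero_of_infinite_isRoot p ((Set.Icc_infinite (by norm_num : (-1 : ℝ) < 1)).mono h)

theorem continuousOn_eval_div {p q : ℝ[X]} (hq : ∀ x ∈ Set.Icc (-1 : ℝ) 1, 0 < q.eval x) :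
    ContinuousOn (fun x => p.eval x / q.eval x) (Set.Icc (-1 : ℝ) 1) :=
  p.continuous.continuousOn.div q.continuous.continuousOn fun x hx => (hq x hx).ne'

theorem continuousOn_of_mem_basisSpan {t : ℕ → ℝ} (ht : ∀ k, t k ∈ Set.Ioo (-1 : ℝ) 1)
    {m : ℕ} {φ : ℝ → ℝ} (hφ : φ ∈ basisSpan t m) : ContinuousOn φ (Set.Icc (-1 : ℝ) 1) := by
  obtain ⟨p, -, hp⟩ := exists_eq_div_of_mem_basisSpan ht hφ
  exact (continuousOn_eval_div fun x hx => denom_pos ht m hx).congr hp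

end RationalFunctions

/-! ### Weights on `[-1, 1]` -/

section Weights

open Polynomial MeasureTheory

/-- A weight on `[-1, 1]`: an integrable function that is positive almost everywhere. -/
structure IsWeight (v : ℝ → ℝ) : Prop where
  integrableOn : IntegrableOn v (Set.Icc (-1 : ℝ) 1)
  pos : ∀ᵐ x ∂(volume.restrict (Set.Icc (-1 : ℝ) 1)), 0 < v x

namespace IsWeight

variable {v : ℝ → ℝ}

theorem intervalIntegrable (hv : IsWeight v) : IntervalIntegrable v volume (-1) 1 :=
  (intervalIntegrable_iff_integrableOn_Icc_of_le (by norm_num)).2 hv.integrableOn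

theorem intervalIntegrable_mul (hv : IsWeight v) {f : ℝ → ℝ}
    (hf : ContinuousOn f (Set.Icc (-1 : ℝ) 1)) :
    IntervalIntegrable (fun x => f x * v x) volume (-1) 1 :=
  hv.intervalIntegrable.continuousOn_mul (by rwa [Set.uIcc_of_le (by norm_num)])

theorem div (hv : IsWeight v) {d : ℝ → ℝ} (hd : ContinuousOn d (Set.Icc (-1 : ℝ) 1))
    (hpos : ∀ x ∈ Set.Icc (-1 : ℝ) 1, 0 < d x) : IsWeight fun x => v x / d x where
  integrableOn := by
    have h := hv.intervalIntegrable_mul (hd.inv₀ fun x hx => (hpos x hx).ne')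
    refine ((intervalIntegrable_iff_integrableOn_Icc_of_le (by norm_num)).1 h).congr_fun ?_
      measurableSet_Icc
    intro x _
    simp [div_eq_inv_mul]
  pos := by
    filter_upwards [hv.pos, ae_restrict_mem measurableSet_Icc] with x hx hm
    exact div_pos hx (hpos x hm)

theorem integral_nonneg (hv : IsWeight v) {f : ℝ → ℝ} (hf : ∀ x ∈ Set.Icc (-1 : ℝ) 1, 0 ≤ f x) :
    0 ≤ ∫ x in (-1 : ℝ)..1, f x * v x := by
  refine intervalIntegral.integral_nonneg_of_ae_restrict (by norm_num) ?_
  filter_upwards [hv.pos, ae_restrict_mem measurableSet_Icc] with x hx hm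
  exact mul_nonneg (hf x hm) hx.le

theorem eq_zero_of_integral_eq_zero (hv : IsWeight v) {f : ℝ → ℝ}
    (hc : ContinuousOn f (Set.Icc (-1 : ℝ) 1)) (hf : ∀ x ∈ Set.Icc (-1 : ℝ) 1, 0 ≤ f x)
    (h0 : ∫ x in (-1 : ℝ)..1, f x * v x = 0) : ∀ x ∈ Set.Icc (-1 : ℝ) 1, f x = 0 := by
  rw [intervalIntegral.integral_of_le (by norm_num), ← integral_Icc_eq_integral_Ioc,
    setIntegral_eq_zero_iff_of_nonneg_ae] at h0
  · have : f =ᵐ[volume.restrict (Set.Icc (-1 : ℝ) 1)] 0 := by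
      filter_upwards [h0, hv.pos] with x h1 h2
      simpa [h2.ne'] using h1
    exact Measure.eqOn_Icc_of_ae_eq volume (by norm_num) this hc continuousOn_const
  · filter_upwards [hv.pos, ae_restrict_mem measurableSet_Icc] with x hx hm
    exact mul_nonneg (hf x hm) hx.le
  · exact (intervalIntegrable_iff_integrableOn_Icc_of_le (by norm_num)).1
      (hv.intervalIntegrable_mul hc)

/-- The linear functional `g ↦ ∫ g v` on polynomials. -/
noncomputable def polyIntegral (hv : IsWeight v) : ℝ[X] →ₗ[ℝ] ℝ where
  toFun g := ∫ x in (-1 : ℝ)..1, g.eval x * v x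
  map_add' p q := by
    simp only [eval_add, add_mul]
    exact intervalIntegral.integral_add (hv.intervalIntegrable_mul p.continuous.continuousOn)
      (hv.intervalIntegrable_mul q.continuous.continuousOn)
  map_smul' a p := by
    simp only [eval_smul, smul_eq_mul, mul_assoc, RingHom.id_apply]
    exact intervalIntegral.integral_const_mul _ _

theorem polyIntegral_apply (hv : IsWeight v) (g : ℝ[X]) :
    hv.polyIntegral g = ∫ x in (-1 : ℝ)..1, g.eval x * v x := rfl

end IsWeight

end Weights

/-! ### Sign changes of a polynomial -/

section SignChanges

open Polynomial

theorem sign_const_of_no_root {p : ℝ[X]} (h : ∀ x ∈ Set.Ioo (-1 : ℝ) 1, p.eval x ≠ 0) :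
    (∀ x ∈ Set.Icc (-1 : ℝ) 1, 0 ≤ p.eval x) ∨ ∀ x ∈ Set.Icc (-1 : ℝ) 1, p.eval x ≤ 0 := by
  by_contra! hcon
  obtain ⟨⟨x, hx, hxp⟩, y, hy, hyp⟩ := hcon
  have key : ∃ z ∈ Set.Ioo (-1 : ℝ) 1, p.eval z = 0 := by
    rcases lt_trichotomy x y with hxy | rfl | hxy
    · obtain ⟨z, hz, hz0⟩ := intermediate_value_Ioo hxy.le p.continuous.continuousOn ⟨hxp, hyp⟩
      exact ⟨z, ⟨hx.1.trans_lt hz.1, hz.2.trans_le hy.2⟩, hz0⟩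
    · exact absurd hxp hyp.not_gt
    · obtain ⟨z, hz, hz0⟩ := intermediate_value_Ioo' hxy.le p.continuous.continuousOn ⟨hxp, hyp⟩
      exact ⟨z, ⟨hy.1.trans_lt hz.1, hz.2.trans_le hx.2⟩, hz0⟩
  obtain ⟨z, hz, hz0⟩ := key
  exact h z hz hz0

/-- The points `R` are those where `p` changes sign, i.e. the roots of odd multiplicity in
`(-1, 1)`. They are collected by removing the roots one by one. -/
theorem exists_finset_sign_const (p : ℝ[X]) (hp : p ≠ 0) :
    ∃ R : Finset ℝ, (∀ r ∈ R, r ∈ Set.Ioo (-1 : ℝ) 1 ∧ p.eval r = 0) ∧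
      ((∀ x ∈ Set.Icc (-1 : ℝ) 1, 0 ≤ p.eval x * ∏ r ∈ R, (x - r)) ∨
        ∀ x ∈ Set.Icc (-1 : ℝ) 1, p.eval x * ∏ r ∈ R, (x - r) ≤ 0) := by
  induction hd : p.natDegree generalizing p with
  | zero =>
    refine ⟨∅, by simp, ?_⟩
    simp only [Finset.prod_empty, mul_one]
    refine sign_const_of_no_root fun x _ h => hp ?_
    rw [eq_C_of_natDegree_eq_zero hd] at h ⊢
    simpa using h
  | succ d ih =>
    by_cases h : ∀ x ∈ Set.Ioo (-1 : ℝ) 1, p.eval x ≠ 0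
    · refine ⟨∅, by simp, ?_⟩
      simpa only [Finset.prod_empty, mul_one] using sign_const_of_no_root h
    push Not at h
    obtain ⟨z, hz, hz0⟩ := h
    obtain ⟨q, rfl⟩ := dvd_iff_isRoot.2 hz0
    have hq : q ≠ 0 := right_ne_zero_of_mul hp
    have hqd : q.natDegree = d := by
      rw [natDegree_mul (X_sub_C_ne_zero z) hq, natDegree_X_sub_C] at hd
      omega
    obtain ⟨R, hR, hs⟩ := ih q hq hqd
    by_cases hzR : z ∈ R
    · refine ⟨R.erase z, fun r hr => ⟨(hR r (Finset.mem_of_mem_erase hr)).1, ?_⟩, ?_⟩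
      · rw [eval_mul, (hR r (Finset.mem_of_mem_erase hr)).2, mul_zero]
      · have key : ∀ x, ((X - C z) * q).eval x * ∏ r ∈ R.erase z, (x - r)
            = q.eval x * ∏ r ∈ R, (x - r) := fun x => by
          rw [← Finset.mul_prod_erase R _ hzR]
          simp only [eval_mul, eval_sub, eval_X, eval_C]
          ring
        simpa only [key] using hs
    · refine ⟨insert z R, ?_, ?_⟩
      · intro r hr
        rcases Finset.mem_insert.1 hr with rfl | hr
        · exact ⟨hz, hz0⟩
        · exact ⟨(hR r hr).1, by rw [eval_mul, (hR r hr).2, mul_zero]⟩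
      · have key : ∀ x, ((X - C z) * q).eval x * ∏ r ∈ insert z R, (x - r)
            = (x - z) ^ 2 * (q.eval x * ∏ r ∈ R, (x - r)) := fun x => by
          rw [Finset.prod_insert hzR]
          simp only [eval_mul, eval_sub, eval_X, eval_C]
          ring
        simp only [key]
        exact hs.imp (fun h x hx => mul_nonneg (sq_nonneg _) (h x hx))
          (fun h x hx => mul_nonpos_of_nonneg_of_nonpos (sq_nonneg _) (h x hx))

end SignChanges

/-! ### Zeros of orthogonal polynomials and double degree of exactness -/

section GaussTheory

open Polynomial MeasureTheory

variable {v : ℝ → ℝ}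

/-- The zeros of an orthogonal polynomial are real, simple and lie in `(-1, 1)`: with fewer than
`n` sign changes, the product with the polynomial vanishing at them would be a function of
constant sign with integral zero. -/
theorem IsWeight.exists_zeros (hv : IsWeight v) {n : ℕ} {p : ℝ[X]} (hp : p ≠ 0)
    (hdeg : p.degree < (n + 1 : ℕ))
    (horth : ∀ s : ℝ[X], s.degree < (n : ℕ) → hv.polyIntegral (p * s) = 0) :
    ∃ x : Fin n → ℝ, StrictMono x ∧ (∀ j, x j ∈ Set.Ioo (-1 : ℝ) 1) ∧
      ∀ y, p.eval y = 0 ↔ y ∈ Set.range x := by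
  obtain ⟨R, hR, hs⟩ := exists_finset_sign_const p hp
  have hnat : p.natDegree ≤ n := Nat.lt_succ_iff.1 ((natDegree_lt_iff_degree_lt hp).2 hdeg)
  have hroots : R ⊆ p.roots.toFinset := fun r hr => by
    rw [Multiset.mem_toFinset, mem_roots hp]
    exact (hR r hr).2
  have hcard : p.roots.toFinset.card ≤ n :=
    (Multiset.toFinset_card_le _).trans ((card_roots' p).trans hnat)
  have hRn : n ≤ R.card := by
    by_contra! hlt
    set s : ℝ[X] := ∏ r ∈ R, (X - C r) with hsdef
    have hse : ∀ x, s.eval x = ∏ r ∈ R, (x - r) := fun x => by simp [hsdef, eval_prod]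
    have hs0 : s ≠ 0 := Finset.prod_ne_zero_iff.2 fun r _ => X_sub_C_ne_zero r
    have hsd : s.degree < (n : ℕ) := by
      rw [hsdef, degree_prod]
      simpa using hlt
    have h0 := horth s hsd
    rw [IsWeight.polyIntegral_apply] at h0
    have hps : p * s = 0 := by
      apply eq_zero_of_eval_eq_zero_on
      rcases hs with hs | hs
      · exact hv.eq_zero_of_integral_eq_zero (p * s).continuous.continuousOn
          (fun x hx => by rw [eval_mul, hse]; exact hs x hx) h0
      · intro x hx
        have h1 := hv.eq_zero_of_integral_eq_zero (f := fun x => -(p * s).eval x)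
          (p * s).continuous.neg.continuousOn
          (fun x hx => by rw [eval_mul, hse]; linarith [hs x hx])
          (by simp only [neg_mul, intervalIntegral.integral_neg, h0, neg_zero]) x hx
        exact neg_eq_zero.1 h1
    exact mul_ne_zero hp hs0 hps
  have hReq : R = p.roots.toFinset := Finset.eq_of_subset_of_card_le hroots (hcard.trans hRn)
  have hc : R.card = n := le_antisymm (hReq ▸ hcard) hRn
  refine ⟨R.orderEmbOfFin hc, (R.orderEmbOfFin hc).strictMono,
    fun j => (hR _ (R.orderEmbOfFin_mem hc j)).1, fun y => ?_⟩
  rw [Finset.range_orderEmbOfFin, hReq, Finset.mem_coe, Multiset.mem_toFinset, mem_roots hp]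
  rfl

/-- Orthogonality to `1, X, …, X ^ (n - 1)` is a system of `n` linear equations for the `n + 1`
coefficients of a polynomial of degree at most `n`. -/
theorem IsWeight.exists_orthogonal_polynomial (hv : IsWeight v) (n : ℕ) :
    ∃ p : ℝ[X], p ≠ 0 ∧ p.degree < (n + 1 : ℕ) ∧
      ∀ s : ℝ[X], s.degree < (n : ℕ) → hv.polyIntegral (p * s) = 0 := by
  let F : degreeLT ℝ (n + 1) →ₗ[ℝ] (Fin n → ℝ) := LinearMap.pi fun i =>
    hv.polyIntegral ∘ₗ (LinearMap.mulRight ℝ (X ^ (i : ℕ))) ∘ₗ (degreeLT ℝ (n + 1)).subtype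
  have hfin : FiniteDimensional ℝ (degreeLT ℝ (n + 1)) :=
    (degreeLTEquiv ℝ (n + 1)).symm.finiteDimensional
  have hker : LinearMap.ker F ≠ ⊥ := by
    apply LinearMap.ker_ne_bot_of_finrank_lt
    rw [(degreeLTEquiv ℝ (n + 1)).finrank_eq]
    simp
  obtain ⟨p, hp, hp0⟩ := (Submodule.ne_bot_iff _).1 hker
  refine ⟨p, by simpa using hp0, mem_degreeLT.1 p.2, fun s hs => ?_⟩
  have hFp : ∀ i : Fin n, hv.polyIntegral ((p : ℝ[X]) * X ^ (i : ℕ)) = 0 := fun i =>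
    congrFun (LinearMap.mem_ker.1 hp) i
  by_cases hs0 : s = 0
  · simp [hs0]
  rw [s.as_sum_range' n ((natDegree_lt_iff_degree_lt hs0).2 hs), Finset.mul_sum, map_sum]
  refine Finset.sum_eq_zero fun i hi => ?_
  rw [← C_mul_X_pow_eq_monomial, mul_left_comm, ← smul_eq_C_mul, map_smul,
    hFp ⟨i, Finset.mem_range.1 hi⟩, smul_zero]

theorem IsWeight.exists_interpolatory_weights (hv : IsWeight v) {n : ℕ} {x : Fin n → ℝ}
    (hx : Function.Injective x) :
    ∃ γ : Fin n → ℝ, ∀ u : ℝ[X], u.degree < (n : ℕ) →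
      hv.polyIntegral u = ∑ j, γ j * u.eval (x j) := by
  refine ⟨fun j => hv.polyIntegral (Lagrange.basis Finset.univ x j), fun u hu => ?_⟩
  have h := Lagrange.eq_interpolate (s := Finset.univ) (v := x) hx.injOn (f := u) (by simpa using hu)
  conv_lhs => rw [h, Lagrange.interpolate_apply, map_sum]
  refine Finset.sum_congr rfl fun j _ => ?_
  rw [← smul_eq_C_mul, map_smul, smul_eq_mul, mul_comm]

theorem nodal_dvd_of_eval_eq_zero {n : ℕ} {x : Fin n → ℝ} (hx : Function.Injective x) {p : ℝ[X]}
    (hp : ∀ j, p.eval (x j) = 0) : Lagrange.nodal Finset.univ x ∣ p := by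
  rw [Lagrange.nodal_eq]
  exact Finset.prod_dvd_of_coprime ((pairwise_coprime_X_sub_C hx).set_pairwise _)
    fun j _ => dvd_iff_isRoot.2 (hp j)

/-- Doubling the degree of exactness: if the nodes are the zeros of an orthogonal polynomial and the
formula is exact for the multiples `u * e` with `deg u < n` of a polynomial `e` of degree at
most `n` not vanishing at the nodes, then it is exact for all degrees below `2 n`. Indeed the
difference of `g` and the multiple of `e` with the same values at the nodes is a multiple of the
orthogonal polynomial. -/
theorem IsWeight.exact_of_orthogonal (hv : IsWeight v) {n : ℕ} {x γ : Fin n → ℝ}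
    (hx : Function.Injective x) {p e : ℝ[X]} (hp : p ≠ 0) (hdeg : p.degree < (n + 1 : ℕ))
    (horth : ∀ s : ℝ[X], s.degree < (n : ℕ) → hv.polyIntegral (p * s) = 0)
    (hpx : ∀ j, p.eval (x j) = 0) (he : e.degree ≤ (n : ℕ)) (hex : ∀ j, e.eval (x j) ≠ 0)
    (hγ : ∀ u : ℝ[X], u.degree < (n : ℕ) →
      hv.polyIntegral (u * e) = ∑ j, γ j * (u * e).eval (x j))
    {g : ℝ[X]} (hg : g.degree < (2 * n : ℕ)) :
    hv.polyIntegral g = ∑ j, γ j * g.eval (x j) := by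
  have hN0 : (Lagrange.nodal Finset.univ x : ℝ[X]) ≠ 0 := Lagrange.nodal_ne_zero
  have hNd : (Lagrange.nodal Finset.univ x : ℝ[X]).degree = n := by
    rw [Lagrange.degree_nodal]; simp
  have hNnat : (Lagrange.nodal Finset.univ x : ℝ[X]).natDegree = n := by
    rw [Lagrange.natDegree_nodal]; simp
  -- the orthogonal polynomial is a multiple of the nodal one
  obtain ⟨c, hc⟩ := nodal_dvd_of_eval_eq_zero hx hpx
  have hc0 : c ≠ 0 := fun h => hp (by rw [hc, h, mul_zero])
  have hcd : c.natDegree = 0 := by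
    have := (natDegree_lt_iff_degree_lt hp).2 hdeg
    rw [hc, natDegree_mul hN0 hc0, hNnat] at this
    omega
  obtain ⟨a, rfl⟩ : ∃ a, c = C a := ⟨_, eq_C_of_natDegree_eq_zero hcd⟩
  have ha : a ≠ 0 := by simpa using hc0
  set u := Lagrange.interpolate Finset.univ x (fun j => g.eval (x j) / e.eval (x j)) with hu
  have hud : u.degree < (n : ℕ) := by
    have := Lagrange.degree_interpolate_lt (s := Finset.univ) (v := x)
      (fun j => g.eval (x j) / e.eval (x j)) hx.injOn
    rwa [Finset.card_univ, Fintype.card_fin] at this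
  have hux : ∀ j, (u * e).eval (x j) = g.eval (x j) := fun j => by
    rw [eval_mul, hu, Lagrange.eval_interpolate_at_node _ hx.injOn (Finset.mem_univ j),
      div_mul_cancel₀ _ (hex j)]
  obtain ⟨s, hs⟩ := nodal_dvd_of_eval_eq_zero hx (p := g - u * e) fun j => by
    rw [eval_sub, hux, sub_self]
  have hsd : s.degree < (n : ℕ) := by
    by_cases hs0 : s = 0
    · rw [hs0, degree_zero]; exact WithBot.bot_lt_coe n
    have h1 : (g - u * e).degree < (2 * n : ℕ) := by
      refine (degree_sub_le _ _).trans_lt (max_lt hg ?_)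
      by_cases hu0 : u = 0
      · rw [hu0, zero_mul, degree_zero]; exact WithBot.bot_lt_coe _
      refine (degree_mul_le _ _).trans_lt ?_
      rw [degree_eq_natDegree hu0] at hud ⊢
      refine (add_le_add_right he _).trans_lt ?_
      have : u.natDegree < n := by exact_mod_cast hud
      exact_mod_cast (by omega : u.natDegree + n < 2 * n)
    rw [hs, degree_mul, hNd, degree_eq_natDegree hs0] at h1
    rw [degree_eq_natDegree hs0]
    have : n + s.natDegree < 2 * n := by exact_mod_cast h1
    exact_mod_cast (by omega : s.natDegree < n)
  have hsplit : g = u * e + p * (C a⁻¹ * s) := by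
    have hca : (C a * C a⁻¹ : ℝ[X]) = 1 := by rw [← C_mul, mul_inv_cancel₀ ha, C_1]
    rw [hc]
    linear_combination hs - (Lagrange.nodal Finset.univ x * s) * hca
  have h0 : hv.polyIntegral (p * (C a⁻¹ * s)) = 0 := by
    apply horth
    rwa [degree_C_mul (inv_ne_zero ha)]
  conv_lhs => rw [hsplit, map_add, h0, add_zero, hγ u hud]
  exact Finset.sum_congr rfl fun j _ => by rw [hux]

/-- The weights of a formula with double degree of exactness are nonnegative: apply it to the
square of the polynomial vanishing at all nodes but one. -/
theorem IsWeight.weights_nonneg (hv : IsWeight v) {n : ℕ} {x γ : Fin n → ℝ}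
    (hx : Function.Injective x)
    (hγ : ∀ g : ℝ[X], g.degree < (2 * n : ℕ) → hv.polyIntegral g = ∑ j, γ j * g.eval (x j))
    (i : Fin n) : 0 ≤ γ i := by
  set N : ℝ[X] := Lagrange.nodal (Finset.univ.erase i) x with hN
  have hn : 0 < n := i.pos
  have hd : (N ^ 2).degree < (2 * n : ℕ) := by
    rw [degree_pow, hN, Lagrange.degree_nodal, Finset.card_erase_of_mem (Finset.mem_univ i),
      Finset.card_univ, Fintype.card_fin, nsmul_eq_mul]
    exact_mod_cast (by omega : 2 * (n - 1) < 2 * n)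
  have h1 := hγ _ hd
  have hNi : N.eval (x i) ≠ 0 := Lagrange.eval_nodal_not_at_node fun j hj =>
    hx.ne (Finset.ne_of_mem_erase hj).symm
  rw [Finset.sum_eq_single i] at h1
  · have h2 : 0 ≤ hv.polyIntegral (N ^ 2) := hv.integral_nonneg fun y _ => by
      rw [eval_pow]; positivity
    rw [h1, eval_pow] at h2
    exact nonneg_of_mul_nonneg_left h2 (by positivity)
  · intro j _ hj
    rw [eval_pow, hN, Lagrange.eval_nodal_at_node (Finset.mem_erase.2 ⟨hj, Finset.mem_univ j⟩)]
    simp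
  · simp

end GaussTheory

/-! ### Gram–Schmidt orthogonalization -/

section GramSchmidt

open Polynomial MeasureTheory

theorem integral_congr_Icc {f g : ℝ → ℝ} (h : ∀ x ∈ Set.Icc (-1 : ℝ) 1, f x = g x) :
    ∫ x in (-1 : ℝ)..1, f x = ∫ x in (-1 : ℝ)..1, g x :=
  intervalIntegral.integral_congr fun x hx => h x (by rwa [Set.uIcc_of_le (by norm_num)] at hx)

variable {w : ℝ → ℝ} {t : ℕ → ℝ}

theorem ip_comm (f g : ℝ → ℝ) : ip w f g = ip w g f := by
  unfold ip
  congr 1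
  ext x
  ring

theorem ip_add_right (hw : IsWeight w) {f g h : ℝ → ℝ} (hf : ContinuousOn f (Set.Icc (-1 : ℝ) 1))
    (hg : ContinuousOn g (Set.Icc (-1 : ℝ) 1)) (hh : ContinuousOn h (Set.Icc (-1 : ℝ) 1)) :
    ip w f (g + h) = ip w f g + ip w f h := by
  unfold ip
  refine Eq.trans ?_ (intervalIntegral.integral_add (hw.intervalIntegrable_mul (hf.mul hg))
    (hw.intervalIntegrable_mul (hf.mul hh)))
  congr 1
  ext x
  simp only [Pi.add_apply]
  ring

theorem ip_smul_right (f g : ℝ → ℝ) (a : ℝ) : ip w f (a • g) = a * ip w f g := by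
  unfold ip
  rw [← intervalIntegral.integral_const_mul]
  congr 1
  ext x
  simp only [Pi.smul_apply, smul_eq_mul]
  ring

theorem ip_sum_right (hw : IsWeight w) {f : ℝ → ℝ} (hf : ContinuousOn f (Set.Icc (-1 : ℝ) 1))
    {ι : Type*} (s : Finset ι) (c : ι → ℝ) {g : ι → ℝ → ℝ}
    (hg : ∀ i, ContinuousOn (g i) (Set.Icc (-1 : ℝ) 1)) :
    ip w f (∑ i ∈ s, c i • g i) = ∑ i ∈ s, c i * ip w f (g i) := by
  classical
  induction s using Finset.induction_on with
  | empty => simp [ip]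
  | insert i s hi ih =>
    have hc : ContinuousOn (∑ i ∈ s, c i • g i) (Set.Icc (-1 : ℝ) 1) := by
      rw [Finset.sum_fn]
      exact continuousOn_finsetSum s fun i _ => (hg i).const_smul (c i)
    rw [Finset.sum_insert hi, Finset.sum_insert hi,
      ip_add_right hw hf ((hg i).const_smul (c i)) hc, ip_smul_right, ih]

/-- The coefficient of the `i`-th orthogonal function in the projection of the `n`-th basis
function. -/
noncomputable def projCoeff (w : ℝ → ℝ) (t : ℕ → ℝ) (n i : ℕ) : ℝ :=
  ip w (basisFn t n) (orthFn w t i) / ip w (orthFn w t i) (orthFn w t i)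

theorem basisFn_eq (w : ℝ → ℝ) (t : ℕ → ℝ) (n : ℕ) :
    basisFn t n = orthFn w t n + ∑ i : Fin n, projCoeff w t n i • orthFn w t i := by
  ext x
  conv_rhs => rw [Pi.add_apply, orthFn]
  simp [projCoeff]

theorem orthFn_mem_basisSpan (w : ℝ → ℝ) (t : ℕ → ℝ) (n : ℕ) :
    orthFn w t n ∈ basisSpan t (n + 1) := by
  induction n using Nat.strong_induction_on with
  | _ n ih =>
    rw [← sub_eq_iff_eq_add.2 (basisFn_eq w t n)]
    refine Submodule.sub_mem _ (basisFn_mem_basisSpan t n.lt_succ_self)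
      (Submodule.sum_mem _ fun i _ => Submodule.smul_mem _ _ ?_)
    exact basisSpan_mono t (Nat.succ_le_succ i.2.le) (ih i i.2)

theorem continuousOn_orthFn (ht : ∀ k, t k ∈ Set.Ioo (-1 : ℝ) 1) (n : ℕ) :
    ContinuousOn (orthFn w t n) (Set.Icc (-1 : ℝ) 1) :=
  continuousOn_of_mem_basisSpan ht (orthFn_mem_basisSpan w t n)

theorem orthFn_eq_div (ht : ∀ k, t k ∈ Set.Ioo (-1 : ℝ) 1) (hinj : Function.Injective t) (n : ℕ) :
    ∃ p : ℝ[X], p ≠ 0 ∧ p.degree < (n + 1 : ℕ) ∧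
      ∀ x ∈ Set.Icc (-1 : ℝ) 1, orthFn w t n x = p.eval x / (denom t (n + 1)).eval x := by
  have hsum : ∑ i : Fin n, projCoeff w t n i • orthFn w t i ∈ basisSpan t n :=
    Submodule.sum_mem _ fun i _ => Submodule.smul_mem _ _
      (basisSpan_mono t i.2 (orthFn_mem_basisSpan w t i))
  obtain ⟨u, hu, hue⟩ := exists_eq_div_of_mem_basisSpan ht hsum
  obtain ⟨p, hp, hpe⟩ := exists_eq_div_of_mem_basisSpan ht (orthFn_mem_basisSpan w t n)
  refine ⟨p, ?_, hp, hpe⟩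
  rintro rfl
  have hne : ∀ k < n, t n ≠ t k := fun k hk h => hk.ne' (hinj h)
  -- otherwise the last basis function would be a combination of the previous ones
  have hzero : denom t n - (1 + C (t n) * X) * u = 0 := by
    apply eq_zero_of_eval_eq_zero_on
    intro x hx
    have h1 := (denom_pos ht n hx).ne'
    have h2 := (one_add_mul_pos (ht n) hx).ne'
    have h3 := congrFun (basisFn_eq w t n) x
    rw [Pi.add_apply, hue x hx, hpe x hx, basisFn, eval_zero, zero_div, zero_add,
      div_eq_div_iff h2 h1] at h3
    simp only [eval_sub, eval_mul, eval_add, eval_one, eval_C, eval_X]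
    linarith
  by_cases h0 : t n = 0
  · have h1 := congrArg (fun q : ℝ[X] => q.coeff n) hzero
    simp only [h0, C_0, zero_mul, add_zero, one_mul, coeff_sub, coeff_zero,
      coeff_eq_zero_of_degree_lt hu, sub_zero, coeff_denom] at h1
    obtain ⟨k, hk, hk0⟩ := Finset.prod_eq_zero_iff.1 h1
    exact hne k (Finset.mem_range.1 hk) (h0.trans hk0.symm)
  · have h1 := congrArg (eval (-1 / t n)) hzero
    have h2 : 1 + t n * (-1 / t n) = 0 := by field_simp; norm_num
    simp only [eval_sub, eval_mul, eval_add, eval_one, eval_C, eval_X, eval_zero, h2, zero_mul,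
      sub_zero] at h1
    exact eval_denom_ne_zero hne h0 h1

theorem ip_orthFn_self_ne_zero (hw : IsWeight w) (ht : ∀ k, t k ∈ Set.Ioo (-1 : ℝ) 1)
    (hinj : Function.Injective t) (n : ℕ) : ip w (orthFn w t n) (orthFn w t n) ≠ 0 := by
  intro h
  obtain ⟨p, hp, -, hpe⟩ := orthFn_eq_div (w := w) ht hinj n
  have hc := continuousOn_orthFn (w := w) ht n
  refine hp (eq_zero_of_eval_eq_zero_on fun x hx => ?_)
  have h1 := hw.eq_zero_of_integral_eq_zero (hc.mul hc) (fun x _ => mul_self_nonneg _) h x hx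
  have h2 := mul_self_eq_zero.1 h1
  rw [hpe x hx, div_eq_zero_iff] at h2
  exact h2.resolve_right (denom_pos ht _ hx).ne'

theorem ip_orthFn_orthFn (hw : IsWeight w) (ht : ∀ k, t k ∈ Set.Ioo (-1 : ℝ) 1)
    (hinj : Function.Injective t) {n m : ℕ} (hmn : m < n) :
    ip w (orthFn w t n) (orthFn w t m) = 0 := by
  induction n using Nat.strong_induction_on generalizing m with
  | _ n ih =>
    have hc := fun k => continuousOn_orthFn (w := w) ht k
    have hsc : ContinuousOn (∑ i : Fin n, projCoeff w t n i • orthFn w t i)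
        (Set.Icc (-1 : ℝ) 1) := by
      rw [Finset.sum_fn]
      exact continuousOn_finsetSum _ fun i _ => (hc i).const_smul _
    have h1 := congrArg (ip w (orthFn w t m)) (basisFn_eq w t n)
    rw [ip_add_right hw (hc m) (hc n) hsc, ip_sum_right hw (hc m) _ _ fun i : Fin n => hc i,
      Finset.sum_eq_single (⟨m, hmn⟩ : Fin n)] at h1
    · rw [projCoeff, div_mul_cancel₀ _ (ip_orthFn_self_ne_zero hw ht hinj m),
        ip_comm (orthFn w t m) (basisFn t n)] at h1
      rw [ip_comm]
      linarith
    · intro i _ hi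
      have hne : (i : ℕ) ≠ m := fun h => hi (Fin.ext h)
      rcases hne.lt_or_gt with h | h
      · rw [ih m hmn h, mul_zero]
      · rw [ip_comm, ih i i.2 h, mul_zero]
    · simp

theorem ip_orthFn_of_mem_basisSpan (hw : IsWeight w) (ht : ∀ k, t k ∈ Set.Ioo (-1 : ℝ) 1)
    (hinj : Function.Injective t) {n : ℕ} {φ : ℝ → ℝ} (hφ : φ ∈ basisSpan t n) :
    ip w (orthFn w t n) φ = 0 := by
  have hc := fun k => continuousOn_orthFn (w := w) ht k
  induction hφ using Submodule.span_induction with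
  | mem φ h =>
    obtain ⟨k, rfl⟩ := h
    have hsc : ContinuousOn (∑ i : Fin k, projCoeff w t k i • orthFn w t i)
        (Set.Icc (-1 : ℝ) 1) := by
      rw [Finset.sum_fn]
      exact continuousOn_finsetSum _ fun i _ => (hc i).const_smul _
    change ip w (orthFn w t n) (basisFn t k) = 0
    rw [basisFn_eq w t k, ip_add_right hw (hc n) (hc k) hsc,
      ip_sum_right hw (hc n) _ _ fun i : Fin k => hc i, ip_orthFn_orthFn hw ht hinj k.2, zero_add]
    exact Finset.sum_eq_zero fun i _ => by
      rw [ip_orthFn_orthFn hw ht hinj (i.2.trans k.2), mul_zero]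
  | zero => simp [ip]
  | add φ ψ hφ hψ h1 h2 =>
    rw [ip_add_right hw (hc n) (continuousOn_of_mem_basisSpan ht hφ)
      (continuousOn_of_mem_basisSpan ht hψ), h1, h2, add_zero]
  | smul a φ _ h => rw [ip_smul_right, h, mul_zero]

end GramSchmidt

/-! ### Exactness for basis functions and for polynomials -/

section Exactness

open Polynomial MeasureTheory

variable {w : ℝ → ℝ} {t : ℕ → ℝ}

theorem ExactOn.integral_eq_of_mem (hw : IsWeight w) (ht : ∀ k, t k ∈ Set.Ioo (-1 : ℝ) 1)
    {m n : ℕ} {x β : Fin n → ℝ} (h : ExactOn w t m x β) {φ : ℝ → ℝ} (hφ : φ ∈ basisSpan t m) :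
    ∫ y in (-1 : ℝ)..1, φ y * w y = ∑ j, β j * φ (x j) := by
  induction hφ using Submodule.span_induction with
  | mem φ hφ =>
    obtain ⟨k, rfl⟩ := hφ
    exact h k k.2
  | zero => simp
  | add φ ψ hφ hψ h1 h2 =>
    simp only [Pi.add_apply, add_mul, mul_add, Finset.sum_add_distrib]
    rw [intervalIntegral.integral_add
      (hw.intervalIntegrable_mul (continuousOn_of_mem_basisSpan ht hφ))
      (hw.intervalIntegrable_mul (continuousOn_of_mem_basisSpan ht hψ)), h1, h2]
  | smul a φ _ h =>
    simp only [Pi.smul_apply, smul_eq_mul, mul_assoc, mul_left_comm _ a]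
    rw [intervalIntegral.integral_const_mul, h, Finset.mul_sum]

theorem IsWeight.div_denom (hw : IsWeight w) (ht : ∀ k, t k ∈ Set.Ioo (-1 : ℝ) 1) (m : ℕ) :
    IsWeight fun x => w x / (denom t m).eval x :=
  hw.div (denom t m).continuous.continuousOn fun _ hx => denom_pos ht m hx

/-- Exactness for the first `m` basis functions is exactness for the polynomials of degree less
than `m` with respect to the weight `w / denom t m`. -/
theorem exactOn_iff (hw : IsWeight w) (ht : ∀ k, t k ∈ Set.Ioo (-1 : ℝ) 1)
    (hinj : Function.Injective t) {m n : ℕ} {x β : Fin n → ℝ}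
    (hx : ∀ j, x j ∈ Set.Icc (-1 : ℝ) 1) :
    ExactOn w t m x β ↔ ∀ u : ℝ[X], u.degree < (m : ℕ) →
      (hw.div_denom ht m).polyIntegral u
        = ∑ j, β j / (denom t m).eval (x j) * u.eval (x j) := by
  have key : ∀ (φ : ℝ → ℝ) (u : ℝ[X]),
      (∀ y ∈ Set.Icc (-1 : ℝ) 1, φ y = u.eval y / (denom t m).eval y) →
      (∫ y in (-1 : ℝ)..1, φ y * w y = ∑ j, β j * φ (x j) ↔
        (hw.div_denom ht m).polyIntegral u
        = ∑ j, β j / (denom t m).eval (x j) * u.eval (x j)) := by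
    intro φ u hφ
    have h1 : ∫ y in (-1 : ℝ)..1, φ y * w y = (hw.div_denom ht m).polyIntegral u := by
      rw [IsWeight.polyIntegral_apply]
      refine integral_congr_Icc fun y hy => ?_
      rw [hφ y hy]
      ring
    have h2 : ∑ j, β j * φ (x j) = ∑ j, β j / (denom t m).eval (x j) * u.eval (x j) :=
      Finset.sum_congr rfl fun j _ => by
        rw [hφ _ (hx j)]
        ring
    rw [h1, h2]
  constructor
  · intro h u hu
    obtain ⟨φ, hφ, hφe⟩ := exists_mem_basisSpan_eq_div ht hinj m hu
    exact (key φ u hφe).1 (h.integral_eq_of_mem hw ht hφ)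
  · intro h k hk
    obtain ⟨u, hu, hue⟩ := exists_eq_div_of_mem_basisSpan ht (basisFn_mem_basisSpan t hk)
    exact (key _ u hue).2 (h u hu)

end Exactness

/-! ### Gaussian quadrature -/

section GaussianQuadrature

open Polynomial

variable {w : ℝ → ℝ} {t : ℕ → ℝ}

theorem exists_isGaussianQuadrature (hw : IsWeight w) (ht : ∀ k, t k ∈ Set.Ioo (-1 : ℝ) 1)
    (hinj : Function.Injective t) (n : ℕ) :
    ∃ x β : Fin n → ℝ, IsGaussianQuadrature w t n x β := by
  have hv := hw.div_denom ht (2 * n)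
  obtain ⟨p, hp, hdeg, horth⟩ := hv.exists_orthogonal_polynomial n
  obtain ⟨x, hmono, hx, hpx⟩ := hv.exists_zeros hp hdeg horth
  obtain ⟨γ, hγ⟩ := hv.exists_interpolatory_weights hmono.injective
  have hxI : ∀ j, x j ∈ Set.Icc (-1 : ℝ) 1 := fun j => Set.Ioo_subset_Icc_self (hx j)
  refine ⟨x, fun j => γ j * (denom t (2 * n)).eval (x j), hmono, hxI, ?_⟩
  rw [exactOn_iff hw ht hinj hxI]
  intro g hg
  have := hv.exact_of_orthogonal hmono.injective (e := 1) hp hdeg horth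
    (fun j => (hpx _).2 ⟨j, rfl⟩) (degree_one_le.trans (by exact_mod_cast n.zero_le)) (by simp)
    (by simpa using hγ) hg
  rw [this]
  refine Finset.sum_congr rfl fun j _ => ?_
  rw [mul_div_cancel_right₀ _ (denom_pos ht _ (hxI j)).ne']

theorem IsGaussianQuadrature.weights_nonneg (hw : IsWeight w)
    (ht : ∀ k, t k ∈ Set.Ioo (-1 : ℝ) 1) (hinj : Function.Injective t) {n : ℕ} {x β : Fin n → ℝ}
    (h : IsGaussianQuadrature w t n x β) (j : Fin n) : 0 ≤ β j := by
  have h1 := (exactOn_iff hw ht hinj h.mem_Icc).1 h.exactOn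
  have h2 := (hw.div_denom ht (2 * n)).weights_nonneg h.strictMono.injective h1 j
  have h3 := denom_pos ht (2 * n) (h.mem_Icc j)
  simpa [div_mul_cancel₀ _ h3.ne'] using mul_nonneg h2 h3.le

end GaussianQuadrature

/-! ### Orthogonal quadrature -/

section OrthogonalQuadrature

open Polynomial

variable {w : ℝ → ℝ} {t : ℕ → ℝ}

theorem degree_denom_succ_le (h0 : t 0 = 0) (n : ℕ) : (denom t (n + 1)).degree ≤ n := by
  induction n with
  | zero => simp [denom_succ, denom_zero, h0]
  | succ n ih =>
    rw [denom_succ, Nat.cast_succ]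
    exact (degree_mul_le _ _).trans (add_le_add ih (degree_linear_le _))

theorem IsWeight.div_denom_mul (hw : IsWeight w) (ht : ∀ k, t k ∈ Set.Ioo (-1 : ℝ) 1) (n : ℕ) :
    IsWeight fun x => w x / ((denom t n).eval x * (denom t (n + 1)).eval x) :=
  hw.div ((denom t n).continuous.mul (denom t (n + 1)).continuous).continuousOn
    fun _ hx => mul_pos (denom_pos ht n hx) (denom_pos ht (n + 1) hx)

/-- The numerator of the orthogonal function is an orthogonal polynomial with respect to the weight
`w / (denom t n * denom t (n + 1))`. -/
theorem orthFn_numerator (hw : IsWeight w) (ht : ∀ k, t k ∈ Set.Ioo (-1 : ℝ) 1)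
    (hinj : Function.Injective t) (n : ℕ) :
    ∃ p : ℝ[X], p ≠ 0 ∧ p.degree < (n + 1 : ℕ) ∧
      (∀ y ∈ Set.Icc (-1 : ℝ) 1, orthFn w t n y = 0 ↔ p.eval y = 0) ∧
      ∀ s : ℝ[X], s.degree < (n : ℕ) → (hw.div_denom_mul ht n).polyIntegral (p * s) = 0 := by
  obtain ⟨p, hp, hdeg, hpe⟩ := orthFn_eq_div (w := w) ht hinj n
  refine ⟨p, hp, hdeg, fun y hy => ?_, fun s hs => ?_⟩
  · rw [hpe y hy, div_eq_zero_iff, or_iff_left (denom_pos ht _ hy).ne']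
  · obtain ⟨φ, hφ, hφe⟩ := exists_mem_basisSpan_eq_div ht hinj n hs
    rw [← ip_orthFn_of_mem_basisSpan hw ht hinj hφ, IsWeight.polyIntegral_apply, ip]
    refine integral_congr_Icc fun y hy => ?_
    rw [hφe y hy, hpe y hy, eval_mul]
    have h1 := (denom_pos ht n hy).ne'
    have h2 := (denom_pos ht (n + 1) hy).ne'
    field_simp

theorem exists_isOrthogonalQuadrature (hw : IsWeight w) (ht : ∀ k, t k ∈ Set.Ioo (-1 : ℝ) 1)
    (hinj : Function.Injective t) (n : ℕ) :
    ∃ x β : Fin n → ℝ, IsOrthogonalQuadrature w t n x β := by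
  obtain ⟨p, hp, hdeg, hpz, horth⟩ := orthFn_numerator hw ht hinj n
  obtain ⟨x, hmono, hx, hpx⟩ := (hw.div_denom_mul ht n).exists_zeros hp hdeg horth
  obtain ⟨γ, hγ⟩ := (hw.div_denom ht n).exists_interpolatory_weights hmono.injective
  have hxI : ∀ j, x j ∈ Set.Icc (-1 : ℝ) 1 := fun j => Set.Ioo_subset_Icc_self (hx j)
  refine ⟨x, fun j => γ j * (denom t n).eval (x j), hmono, ?_, ?_⟩
  · ext y
    constructor
    · rintro ⟨j, rfl⟩
      exact ⟨hxI j, (hpz _ (hxI j)).2 ((hpx _).2 ⟨j, rfl⟩)⟩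
    · rintro ⟨hy, hy0⟩
      exact (hpx y).1 ((hpz y hy).1 hy0)
  · rw [exactOn_iff hw ht hinj hxI]
    intro u hu
    rw [hγ u hu]
    refine Finset.sum_congr rfl fun j _ => ?_
    rw [mul_div_cancel_right₀ _ (denom_pos ht _ (hxI j)).ne']

theorem IsOrthogonalQuadrature.mem_Icc {n : ℕ} {x β : Fin n → ℝ}
    (h : IsOrthogonalQuadrature w t n x β) (j : Fin n) : x j ∈ Set.Icc (-1 : ℝ) 1 :=
  (h.range_eq.le ⟨j, rfl⟩ : x j ∈ {y | y ∈ Set.Icc (-1 : ℝ) 1 ∧ orthFn w t n y = 0}).1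

/-- As `t 0 = 0`, the polynomial `denom t (n + 1)` has degree at most `n`, so orthogonal quadrature
with `n` nodes has the double degree of exactness for the weight
`w / (denom t n * denom t (n + 1))`. -/
theorem IsOrthogonalQuadrature.exact (hw : IsWeight w)
    (ht : ∀ k, t k ∈ Set.Ioo (-1 : ℝ) 1) (hinj : Function.Injective t) (h0 : t 0 = 0) {n : ℕ}
    {x β : Fin n → ℝ} (h : IsOrthogonalQuadrature w t n x β) {g : ℝ[X]}
    (hg : g.degree < (2 * n : ℕ)) :
    (hw.div_denom_mul ht n).polyIntegral g
      = ∑ j, β j / ((denom t n).eval (x j) * (denom t (n + 1)).eval (x j)) * g.eval (x j) := by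
  obtain ⟨p, hp, hdeg, hpz, horth⟩ := orthFn_numerator hw ht hinj n
  have hzero : ∀ j, orthFn w t n (x j) = 0 := fun j =>
    (h.range_eq.le ⟨j, rfl⟩ : x j ∈ {y | y ∈ Set.Icc (-1 : ℝ) 1 ∧ orthFn w t n y = 0}).2
  refine (hw.div_denom_mul ht n).exact_of_orthogonal h.strictMono.injective hp hdeg horth
    (fun j => (hpz _ (h.mem_Icc j)).1 (hzero j)) (degree_denom_succ_le h0 n)
    (fun j => (denom_pos ht _ (h.mem_Icc j)).ne') (fun u hu => ?_) hg
  have h1 := (exactOn_iff hw ht hinj h.mem_Icc).1 h.exactOn u hu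
  have h2 : (hw.div_denom_mul ht n).polyIntegral (u * denom t (n + 1))
      = (hw.div_denom ht n).polyIntegral u := by
    rw [IsWeight.polyIntegral_apply, IsWeight.polyIntegral_apply]
    refine integral_congr_Icc fun y hy => ?_
    have h3 := (denom_pos ht n hy).ne'
    have h4 := (denom_pos ht (n + 1) hy).ne'
    rw [eval_mul]
    field_simp
  rw [h2, h1]
  refine Finset.sum_congr rfl fun j _ => ?_
  have h3 := (denom_pos ht n (h.mem_Icc j)).ne'
  have h4 := (denom_pos ht (n + 1) (h.mem_Icc j)).ne'
  rw [eval_mul]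
  field_simp

theorem IsOrthogonalQuadrature.weights_nonneg (hw : IsWeight w)
    (ht : ∀ k, t k ∈ Set.Ioo (-1 : ℝ) 1) (hinj : Function.Injective t) (h0 : t 0 = 0) {n : ℕ}
    {x β : Fin n → ℝ} (h : IsOrthogonalQuadrature w t n x β) (j : Fin n) : 0 ≤ β j := by
  have h2 := (hw.div_denom_mul ht n).weights_nonneg h.strictMono.injective
    (fun g hg => h.exact hw ht hinj h0 hg) j
  have h3 := mul_pos (denom_pos ht n (h.mem_Icc j)) (denom_pos ht (n + 1) (h.mem_Icc j))
  simpa [div_mul_cancel₀ _ h3.ne'] using mul_nonneg h2 h3.le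

theorem IsOrthogonalQuadrature.exactOn_succ (hw : IsWeight w)
    (ht : ∀ k, t k ∈ Set.Ioo (-1 : ℝ) 1) (hinj : Function.Injective t) (h0 : t 0 = 0) {n : ℕ}
    (hn : 1 ≤ n) {x β : Fin n → ℝ} (h : IsOrthogonalQuadrature w t n x β) :
    ExactOn w t (n + 1) x β := by
  rw [exactOn_iff hw ht hinj h.mem_Icc]
  intro u hu
  obtain ⟨n, rfl⟩ : ∃ k, n = k + 1 := ⟨n - 1, by omega⟩
  have hdeg : (u * denom t (n + 1)).degree < (2 * (n + 1) : ℕ) := by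
    by_cases hu0 : u = 0
    · rw [hu0, zero_mul, degree_zero]; exact WithBot.bot_lt_coe _
    refine (degree_mul_le _ _).trans_lt (
      (add_le_add_right (degree_denom_succ_le h0 n) _).trans_lt ?_)
    rw [degree_eq_natDegree hu0] at hu ⊢
    have : u.natDegree < n + 1 + 1 := by exact_mod_cast hu
    exact_mod_cast (by omega : u.natDegree + n < 2 * (n + 1))
  have h1 := h.exact hw ht hinj h0 hdeg
  have h2 : (hw.div_denom ht (n + 1 + 1)).polyIntegral u
      = (hw.div_denom_mul ht (n + 1)).polyIntegral (u * denom t (n + 1)) := by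
    rw [IsWeight.polyIntegral_apply, IsWeight.polyIntegral_apply]
    refine integral_congr_Icc fun y hy => ?_
    have h3 := (denom_pos ht (n + 1) hy).ne'
    have h4 := (denom_pos ht (n + 1 + 1) hy).ne'
    rw [eval_mul]
    field_simp
  rw [h2, h1]
  refine Finset.sum_congr rfl fun j _ => ?_
  have h3 := (denom_pos ht (n + 1) (h.mem_Icc j)).ne'
  have h4 := (denom_pos ht (n + 1 + 1) (h.mem_Icc j)).ne'
  rw [eval_mul]
  field_simp

end OrthogonalQuadrature

/-! ### Error bound for positive formulas -/

section ErrorBound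

open MeasureTheory

variable {w : ℝ → ℝ} {t : ℕ → ℝ}

/-- A quadrature formula with nodes in `[-1, 1]` and nonnegative weights that is exact for the
first `m` basis functions. -/
structure IsPositiveExact (w : ℝ → ℝ) (t : ℕ → ℝ) (m : ℕ) {n : ℕ} (x β : Fin n → ℝ) :
    Prop where
  mem_Icc : ∀ j, x j ∈ Set.Icc (-1 : ℝ) 1
  nonneg : ∀ j, 0 ≤ β j
  exactOn : ExactOn w t m x β

theorem IsGaussianQuadrature.isPositiveExact (hw : IsWeight w)
    (ht : ∀ k, t k ∈ Set.Ioo (-1 : ℝ) 1) (hinj : Function.Injective t) {n : ℕ} {x β : Fin n → ℝ}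
    (h : IsGaussianQuadrature w t n x β) : IsPositiveExact w t (2 * n) x β :=
  ⟨h.mem_Icc, h.weights_nonneg hw ht hinj, h.exactOn⟩

theorem IsOrthogonalQuadrature.isPositiveExact (hw : IsWeight w)
    (ht : ∀ k, t k ∈ Set.Ioo (-1 : ℝ) 1) (hinj : Function.Injective t) (h0 : t 0 = 0) {n : ℕ}
    (hn : 1 ≤ n) {x β : Fin n → ℝ} (h : IsOrthogonalQuadrature w t n x β) :
    IsPositiveExact w t (n + 1) x β :=
  ⟨h.mem_Icc, h.weights_nonneg hw ht hinj h0, h.exactOn_succ hw ht hinj h0 hn⟩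

theorem IsWeight.integral_mono (hw : IsWeight w) {f g : ℝ → ℝ}
    (hf : IntervalIntegrable (fun x => f x * w x) volume (-1) 1)
    (hg : IntervalIntegrable (fun x => g x * w x) volume (-1) 1)
    (h : ∀ x ∈ Set.Icc (-1 : ℝ) 1, f x ≤ g x) :
    ∫ x in (-1 : ℝ)..1, f x * w x ≤ ∫ x in (-1 : ℝ)..1, g x * w x := by
  have h1 := hw.integral_nonneg (f := fun x => g x - f x) fun x hx => sub_nonneg.2 (h x hx)
  simp only [sub_mul] at h1
  rw [intervalIntegral.integral_sub hg hf] at h1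
  linarith

/-- The bound of the errors relative to the distance from the span, a common one for all
positive formulas that are exact for `basisFn t 0`. -/
noncomputable def errorConst (w : ℝ → ℝ) (t : ℕ → ℝ) : ℝ :=
  (∫ y in (-1 : ℝ)..1, w y) + 2 * (∫ y in (-1 : ℝ)..1, basisFn t 0 y * w y) + 1

theorem errorConst_pos (hw : IsWeight w) (ht : ∀ k, t k ∈ Set.Ioo (-1 : ℝ) 1) :
    0 < errorConst w t := by
  have h1 : 0 ≤ ∫ y in (-1 : ℝ)..1, w y := by
    simpa using hw.integral_nonneg (f := fun _ => 1) fun _ _ => zero_le_one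
  have h2 : 0 ≤ ∫ y in (-1 : ℝ)..1, basisFn t 0 y * w y := hw.integral_nonneg fun y hy =>
    (one_div_pos.2 (one_add_mul_pos (ht 0) hy)).le
  unfold errorConst
  linarith

theorem IsPositiveExact.sum_weights_le (ht : ∀ k, t k ∈ Set.Ioo (-1 : ℝ) 1) {m n : ℕ}
    (hm : 1 ≤ m) {x β : Fin n → ℝ} (h : IsPositiveExact w t m x β) :
    ∑ j, β j ≤ 2 * ∫ y in (-1 : ℝ)..1, basisFn t 0 y * w y := by
  rw [h.exactOn 0 hm, Finset.mul_sum]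
  refine Finset.sum_le_sum fun j _ => ?_
  have h1 : (1 : ℝ) / 2 ≤ basisFn t 0 (x j) := by
    have hx := h.mem_Icc j
    have hp := one_add_mul_pos (ht 0) hx
    rw [basisFn, div_le_div_iff₀ two_pos hp]
    have := abs_le.2 hx
    have := abs_lt.2 (ht 0)
    have := (le_abs_self (t 0 * x j)).trans_eq (abs_mul _ _)
    nlinarith [abs_nonneg (t 0), abs_nonneg (x j)]
  nlinarith [h.nonneg j]

theorem IsPositiveExact.abs_quadError_le (hw : IsWeight w) (ht : ∀ k, t k ∈ Set.Ioo (-1 : ℝ) 1)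
    {m n : ℕ} (hm : 1 ≤ m) {x β : Fin n → ℝ} (h : IsPositiveExact w t m x β) {f φ : ℝ → ℝ}
    (hf : ContinuousOn f (Set.Icc (-1 : ℝ) 1)) (hφ : φ ∈ basisSpan t m) {δ : ℝ}
    (hδ : ∀ y ∈ Set.Icc (-1 : ℝ) 1, |f y - φ y| ≤ δ) :
    |quadError w f x β| ≤ errorConst w t * δ := by
  have hφc := continuousOn_of_mem_basisSpan ht hφ
  have hδ0 : 0 ≤ δ := (abs_nonneg _).trans (hδ 0 (by norm_num))
  have h1 : quadError w f x β
      = (∫ y in (-1 : ℝ)..1, (f y - φ y) * w y) - ∑ j, β j * (f (x j) - φ (x j)) := by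
    simp only [sub_mul, mul_sub, Finset.sum_sub_distrib]
    rw [intervalIntegral.integral_sub (hw.intervalIntegrable_mul hf)
      (hw.intervalIntegrable_mul hφc), h.exactOn.integral_eq_of_mem hw ht hφ, quadError]
    ring
  have hci : ∀ c : ℝ, IntervalIntegrable (fun y => c * w y) volume (-1) 1 := fun c =>
    hw.intervalIntegrable_mul continuousOn_const
  have hi := hw.intervalIntegrable_mul (hf.sub hφc)
  have h2 : |∫ y in (-1 : ℝ)..1, (f y - φ y) * w y| ≤ (∫ y in (-1 : ℝ)..1, w y) * δ := by
    have hu := hw.integral_mono (f := fun y => f y - φ y) (g := fun _ => δ) hi (hci δ)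
      fun y hy => (abs_le.1 (hδ y hy)).2
    have hl := hw.integral_mono (f := fun _ => -δ) (g := fun y => f y - φ y) (hci (-δ)) hi
      fun y hy => (abs_le.1 (hδ y hy)).1
    rw [intervalIntegral.integral_const_mul] at hu hl
    rw [abs_le]
    constructor <;> linarith
  have h3 : |∑ j, β j * (f (x j) - φ (x j))| ≤ (∑ j, β j) * δ := by
    refine (Finset.abs_sum_le_sum_abs _ _).trans ?_
    rw [Finset.sum_mul]
    refine Finset.sum_le_sum fun j _ => ?_
    rw [abs_mul, abs_of_nonneg (h.nonneg j)]
    exact mul_le_mul_of_nonneg_left (hδ _ (h.mem_Icc j)) (h.nonneg j)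
  have h4 := mul_le_mul_of_nonneg_right (h.sum_weights_le ht hm) hδ0
  rw [h1]
  refine (abs_sub _ _).trans ?_
  unfold errorConst
  linarith

theorem abs_le_supNorm {g : ℝ → ℝ} (hg : ContinuousOn g (Set.Icc (-1 : ℝ) 1)) {y : ℝ}
    (hy : y ∈ Set.Icc (-1 : ℝ) 1) : |g y| ≤ supNorm g := by
  have hb : BddAbove (Set.range fun x : Set.Icc (-1 : ℝ) 1 => |g x|) := by
    have := (isCompact_Icc.image_of_continuousOn hg.abs).bddAbove
    rwa [Set.image_eq_range] at this
  exact le_ciSup hb ⟨y, hy⟩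

theorem IsPositiveExact.abs_quadError_le_supNorm (hw : IsWeight w)
    (ht : ∀ k, t k ∈ Set.Ioo (-1 : ℝ) 1) {m n : ℕ} (hm : 1 ≤ m) {x β : Fin n → ℝ}
    (h : IsPositiveExact w t m x β) {f φ : ℝ → ℝ} (hf : ContinuousOn f (Set.Icc (-1 : ℝ) 1))
    (hφ : φ ∈ basisSpan t m) : |quadError w f x β| ≤ errorConst w t * supNorm (f - φ) :=
  h.abs_quadError_le hw ht hm hf hφ fun _ hy =>
    abs_le_supNorm (hf.sub (continuousOn_of_mem_basisSpan ht hφ)) hy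

end ErrorBound

/-! ### Chebyshev–Markov rational functions -/

section ChebyshevMarkov

open Polynomial

/-- The polynomials `P_m` and `Q_m` with
`P_m + √(X² - 1) Q_m = ∏_{k < m} (X + t_k + √(1 - t_k²) √(X² - 1))`. The quotient
`P_m / denom t m` is the Chebyshev–Markov rational function with the poles `-1 / t_k`; for `t = 0`
it is the Chebyshev polynomial of degree `m`. -/
noncomputable def chebyshevMarkov (t : ℕ → ℝ) : ℕ → ℝ[X] × ℝ[X]
  | 0 => (1, 0)
  | m + 1 =>
    ((X + C (t m)) * (chebyshevMarkov t m).1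
        - C (√(1 - t m ^ 2)) * ((1 - X ^ 2) * (chebyshevMarkov t m).2),
      (X + C (t m)) * (chebyshevMarkov t m).2 + C (√(1 - t m ^ 2)) * (chebyshevMarkov t m).1)

variable {t : ℕ → ℝ}

theorem natDegree_chebyshevMarkov (t : ℕ → ℝ) (m : ℕ) :
    (chebyshevMarkov t m).1.natDegree ≤ m ∧ (X * (chebyshevMarkov t m).2).natDegree ≤ m := by
  induction m with
  | zero => simp [chebyshevMarkov]
  | succ m ih =>
    obtain ⟨h1, h2⟩ := ih
    have hlin : (X + C (t m) : ℝ[X]).natDegree ≤ 1 := by compute_degree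
    have h3 : (chebyshevMarkov t m).2.natDegree ≤ m := by
      by_cases h : (chebyshevMarkov t m).2 = 0
      · simp [h]
      · rw [natDegree_X_mul h] at h2
        omega
    simp only [chebyshevMarkov]
    have e1 : (X + C (t m)) * (chebyshevMarkov t m).1
        - C (√(1 - t m ^ 2)) * ((1 - X ^ 2) * (chebyshevMarkov t m).2)
        = (X + C (t m)) * (chebyshevMarkov t m).1 - C (√(1 - t m ^ 2)) *
          ((chebyshevMarkov t m).2 - X * (X * (chebyshevMarkov t m).2)) := by ring
    have e2 : X * ((X + C (t m)) * (chebyshevMarkov t m).2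
        + C (√(1 - t m ^ 2)) * (chebyshevMarkov t m).1)
        = (X + C (t m)) * (X * (chebyshevMarkov t m).2)
          + X * (C (√(1 - t m ^ 2)) * (chebyshevMarkov t m).1) := by ring
    have hX : ∀ p : ℝ[X], p.natDegree ≤ m → (X * p).natDegree ≤ m + 1 := fun p hp =>
      natDegree_mul_le.trans (by rw [natDegree_X]; omega)
    have hL : ∀ p : ℝ[X], p.natDegree ≤ m → ((X + C (t m)) * p).natDegree ≤ m + 1 := fun p hp =>
      natDegree_mul_le.trans (by omega)
    rw [e1, e2]
    constructor
    · refine (natDegree_sub_le _ _).trans (max_le (hL _ h1) ((natDegree_C_mul_le _ _).trans ?_))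
      exact (natDegree_sub_le _ _).trans (max_le (h3.trans m.le_succ) (hX _ h2))
    · exact (natDegree_add_le _ _).trans
        (max_le (hL _ h2) (hX _ ((natDegree_C_mul_le _ _).trans h1)))

theorem sq_sqrt_one_sub_sq {s : ℝ} (hs : s ∈ Set.Ioo (-1 : ℝ) 1) : √(1 - s ^ 2) ^ 2 = 1 - s ^ 2 :=
  Real.sq_sqrt (by nlinarith [hs.1, hs.2])

theorem chebyshevMarkov_sq_add_sq (ht : ∀ k, t k ∈ Set.Ioo (-1 : ℝ) 1) (m : ℕ) (x : ℝ) :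
    (chebyshevMarkov t m).1.eval x ^ 2 + (1 - x ^ 2) * (chebyshevMarkov t m).2.eval x ^ 2
      = (denom t m).eval x ^ 2 := by
  induction m with
  | zero => simp [chebyshevMarkov, denom_zero]
  | succ m ih =>
    have hs := sq_sqrt_one_sub_sq (ht m)
    rw [denom_succ]
    simp only [chebyshevMarkov, eval_mul, eval_add, eval_sub, eval_X, eval_C, eval_one, eval_pow]
    rw [mul_pow, ← ih]
    linear_combination ((1 - x ^ 2) * ((chebyshevMarkov t m).1.eval x ^ 2
      + (1 - x ^ 2) * (chebyshevMarkov t m).2.eval x ^ 2)) * hs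

theorem abs_chebyshevMarkov_le (ht : ∀ k, t k ∈ Set.Ioo (-1 : ℝ) 1) (m : ℕ) {x : ℝ}
    (hx : x ∈ Set.Icc (-1 : ℝ) 1) : |(chebyshevMarkov t m).1.eval x| ≤ (denom t m).eval x := by
  refine abs_le_of_sq_le_sq ?_ (denom_pos ht m hx).le
  have h1 : 0 ≤ 1 - x ^ 2 := by nlinarith [hx.1, hx.2]
  rw [← chebyshevMarkov_sq_add_sq ht m x]
  nlinarith [mul_nonneg h1 (sq_nonneg ((chebyshevMarkov t m).2.eval x))]

theorem chebyshevMarkov_eval_add {x y : ℝ} (hy : y ^ 2 = x ^ 2 - 1) (m : ℕ) :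
    (chebyshevMarkov t m).1.eval x + y * (chebyshevMarkov t m).2.eval x
      = ∏ k ∈ Finset.range m, (x + t k + √(1 - t k ^ 2) * y) := by
  induction m with
  | zero => simp [chebyshevMarkov]
  | succ m ih =>
    rw [Finset.prod_range_succ, ← ih]
    simp only [chebyshevMarkov, eval_mul, eval_add, eval_sub, eval_X, eval_C, eval_one, eval_pow]
    linear_combination (-√(1 - t m ^ 2) * (chebyshevMarkov t m).2.eval x) * hy

theorem one_add_sum_le_prod_one_add {c : ℕ → ℝ} (m : ℕ) (hc : ∀ k, 0 ≤ c k) :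
    1 + ∑ k ∈ Finset.range m, c k ≤ ∏ k ∈ Finset.range m, (1 + c k) := by
  induction m with
  | zero => simp
  | succ m ih =>
    rw [Finset.sum_range_succ, Finset.prod_range_succ]
    nlinarith [hc m, Finset.sum_nonneg fun k (_ : k ∈ Finset.range m) => hc k]

/-- To the right of `[-1, 1]` the Chebyshev–Markov functions grow with `∑ √(1 - t_k²)`. The factor
`x + t_k + √(1 - t_k²) y` is larger than its conjugate `x + t_k - √(1 - t_k²) y`, and the product
of the two is `(1 + t_k x)²`. -/
theorem chebyshevMarkov_growth (ht : ∀ k, t k ∈ Set.Ioo (-1 : ℝ) 1) {x y : ℝ} (hx : 1 < x)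
    (hy0 : 0 < y) (hy : y ^ 2 = x ^ 2 - 1) (m : ℕ) :
    (1 + 2 * y / (x + 1 + y) * ∑ k ∈ Finset.range m, √(1 - t k ^ 2)) * (denom t m).eval x ^ 2
      ≤ (2 * (chebyshevMarkov t m).1.eval x) ^ 2 := by
  set κ := 2 * y / (x + 1 + y) with hκ
  have hD : 0 < x + 1 + y := by linarith
  have hκ0 : 0 < κ := by positivity
  have hσ0 : ∀ k, 0 ≤ √(1 - t k ^ 2) := fun k => Real.sqrt_nonneg _
  have hσ1 : ∀ k, √(1 - t k ^ 2) ≤ 1 := fun k => by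
    rw [Real.sqrt_le_one]
    linarith [sq_nonneg (t k)]
  have hpos : ∀ k, 0 < x + t k + √(1 - t k ^ 2) * y := fun k => by
    have := (ht k).1
    have := mul_nonneg (hσ0 k) hy0.le
    linarith
  have hconj : ∀ k, (x + t k + √(1 - t k ^ 2) * y) * (x + t k + √(1 - t k ^ 2) * (-y))
      = (1 + t k * x) ^ 2 := fun k => by
    linear_combination (-y ^ 2) * sq_sqrt_one_sub_sq (ht k) - (1 - t k ^ 2) * hy
  have hle : ∀ k, x + t k + √(1 - t k ^ 2) * y ≤ x + 1 + y := fun k => by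
    have := (ht k).2
    have := mul_le_mul_of_nonneg_right (hσ1 k) hy0.le
    linarith
  have hfac : ∀ k, (1 + κ * √(1 - t k ^ 2)) * (1 + t k * x) ^ 2
      ≤ (x + t k + √(1 - t k ^ 2) * y) ^ 2 := fun k => by
    have hc := hconj k
    set A := x + t k + √(1 - t k ^ 2) * y with hA
    have h1 : x + t k + √(1 - t k ^ 2) * (-y) = A - 2 * (√(1 - t k ^ 2) * y) := by rw [hA]; ring
    rw [h1] at hc
    have hA0 := hpos k
    have hz : 0 ≤ √(1 - t k ^ 2) * y := mul_nonneg (hσ0 k) hy0.le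
    have h2 : (1 + t k * x) ^ 2 ≤ A * (x + 1 + y) := by
      rw [← hc]
      exact mul_le_mul_of_nonneg_left (by linarith [hle k]) hA0.le
    have h3 : κ * √(1 - t k ^ 2) * (1 + t k * x) ^ 2 ≤ 2 * (√(1 - t k ^ 2) * y) * A := by
      calc κ * √(1 - t k ^ 2) * (1 + t k * x) ^ 2
          ≤ κ * √(1 - t k ^ 2) * (A * (x + 1 + y)) :=
            mul_le_mul_of_nonneg_left h2 (mul_nonneg hκ0.le (hσ0 k))
        _ = 2 * (√(1 - t k ^ 2) * y) * A := by rw [hκ]; field_simp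
    nlinarith
  have hprod : (1 + κ * ∑ k ∈ Finset.range m, √(1 - t k ^ 2)) * (denom t m).eval x ^ 2
      ≤ (∏ k ∈ Finset.range m, (x + t k + √(1 - t k ^ 2) * y)) ^ 2 := by
    rw [eval_denom, ← Finset.prod_pow, ← Finset.prod_pow]
    refine le_trans (mul_le_mul_of_nonneg_right (?_ : _ ≤ ∏ k ∈ Finset.range m,
      (1 + κ * √(1 - t k ^ 2))) (Finset.prod_nonneg fun k _ => sq_nonneg _)) ?_
    · rw [Finset.mul_sum]
      exact one_add_sum_le_prod_one_add m fun k => mul_nonneg hκ0.le (hσ0 k)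
    · rw [← Finset.prod_mul_distrib]
      exact Finset.prod_le_prod
        (fun k _ => mul_nonneg (by nlinarith [mul_nonneg hκ0.le (hσ0 k)]) (sq_nonneg _))
        fun k _ => hfac k
  refine hprod.trans ?_
  have hplus := chebyshevMarkov_eval_add (t := t) hy m
  have hminus := chebyshevMarkov_eval_add (t := t) (x := x) (y := -y) (by rw [neg_sq, hy]) m
  have hP := Finset.prod_nonneg fun k (_ : k ∈ Finset.range m) => (hpos k).le
  have hM : 0 ≤ ∏ k ∈ Finset.range m, (x + t k + √(1 - t k ^ 2) * (-y)) :=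
    Finset.prod_nonneg fun k _ =>
      nonneg_of_mul_nonneg_right ((sq_nonneg (1 + t k * x)).trans_eq (hconj k).symm) (hpos k)
  rw [← hplus] at hP ⊢
  rw [← hminus] at hM
  exact pow_le_pow_left₀ hP (by linarith) 2

end ChebyshevMarkov

/-! ### Density of the basis functions -/

section Density

open Polynomial

variable {t : ℕ → ℝ}

theorem one_sub_abs_joukowskiParam_le {s : ℝ} (hs : s ∈ Set.Ioo (-1 : ℝ) 1) :
    1 - |joukowskiParam s| ≤ √(1 - s ^ 2) := by
  have hσ := Real.sqrt_nonneg (1 - s ^ 2)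
  have hsq := sq_sqrt_one_sub_sq hs
  have h1 : |s| < 1 := abs_lt.2 hs
  have h2 : |s| ^ 2 = s ^ 2 := sq_abs s
  have hd : 0 < 1 + √(1 - s ^ 2) := by linarith
  rw [joukowskiParam, abs_div, abs_neg, abs_of_pos hd, sub_le_iff_le_add, ← sub_le_iff_le_add',
    le_div_iff₀ hd]
  nlinarith [abs_nonneg s]

theorem DensityCondition.tendsto_sum_sqrt (ht : ∀ k, t k ∈ Set.Ioo (-1 : ℝ) 1)
    (hd : DensityCondition t) :
    Filter.Tendsto (fun m => ∑ k ∈ Finset.range m, √(1 - t (k + 1) ^ 2))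
      Filter.atTop Filter.atTop := by
  have h1 : Filter.Tendsto (fun m => ∑ k ∈ Finset.range m, √(1 - t k ^ 2))
      Filter.atTop Filter.atTop :=
    Filter.tendsto_atTop_mono
      (fun m => Finset.sum_le_sum fun k _ => one_sub_abs_joukowskiParam_le (ht k)) hd
  have h2 := Filter.tendsto_atTop_add_const_right _ (-√(1 - t 0 ^ 2))
    (h1.comp (Filter.tendsto_add_atTop_nat 1))
  refine h2.congr fun m => ?_
  simp only [Function.comp_apply]
  rw [Finset.sum_range_succ']
  ring

theorem denom_succ' (t : ℕ → ℝ) (m : ℕ) :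
    denom t (m + 1) = denom (fun k => t (k + 1)) m * (1 + C (t 0) * X) :=
  Finset.prod_range_succ' _ _

/-- Under the density condition, a function `1 / (1 + s x)` with `-1 < s < 0` that is not itself one
of the basis functions is a uniform limit of their linear combinations. For the approximation,
multiply the Chebyshev–Markov function with the poles of all basis functions but the first one by
`basisFn t 0` and `1 / (1 + s x)`. The product is bounded on `[-1, 1]`, while its partial
fraction decomposition has a large coefficient at `1 / (1 + s x)`. -/
theorem exists_approx_of_density (ht : ∀ k, t k ∈ Set.Ioo (-1 : ℝ) 1)
    (hinj : Function.Injective t) (hd : DensityCondition t) {s : ℝ} (hs1 : -1 < s) (hs0 : s < 0)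
    (hst : ∀ k, s ≠ t k) {ε : ℝ} (hε : 0 < ε) :
    ∃ m, ∃ φ ∈ basisSpan t m, ∀ x ∈ Set.Icc (-1 : ℝ) 1, |1 / (1 + s * x) - φ x| ≤ ε := by
  have hsI : s ∈ Set.Ioo (-1 : ℝ) 1 := ⟨hs1, hs0.trans one_pos⟩
  set t' : ℕ → ℝ := fun k => t (k + 1) with ht'
  have ht'I : ∀ k, t' k ∈ Set.Ioo (-1 : ℝ) 1 := fun k => ht (k + 1)
  -- the pole of `1 / (1 + s x)`
  set x₀ := -1 / s with hx₀
  have hx₀1 : 1 < x₀ := by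
    rw [hx₀, lt_div_iff_of_neg hs0]
    linarith
  set y := √(x₀ ^ 2 - 1) with hydef
  have hy0 : 0 < y := Real.sqrt_pos.2 (by nlinarith)
  have hy : y ^ 2 = x₀ ^ 2 - 1 := Real.sq_sqrt (by nlinarith)
  set κ := 2 * y / (x₀ + 1 + y) with hκ
  have hκ0 : 0 < κ := by positivity
  -- a bound of `basisFn t 0 x / (1 + s x)` on `[-1, 1]`
  set K := (1 / (1 - |t 0|)) * (1 / (1 - |s|)) with hK
  have ha0 : 0 < 1 - |t 0| := by linarith [abs_lt.2 (ht 0)]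
  have has : 0 < 1 - |s| := by linarith [abs_lt.2 hsI]
  have hK0 : 0 < K := by positivity
  have hc0 : 1 + t 0 * x₀ ≠ 0 := by
    intro h
    apply hst 0
    have h1 : t 0 * x₀ * s = -t 0 := by
      rw [hx₀, mul_assoc, div_mul_cancel₀ _ hs0.ne]
      ring
    linear_combination s * h - h1
  obtain ⟨m, hm⟩ := (Filter.tendsto_atTop.1 (hd.tendsto_sum_sqrt ht)
    ((2 * (K / ε) * (1 + t 0 * x₀)) ^ 2 / κ)).exists
  rw [div_le_iff₀' hκ0] at hm
  set P := (chebyshevMarkov t' m).1 with hP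
  have hPd : P.degree < (m + 1 + 1 : ℕ) :=
    degree_le_natDegree.trans_lt (by
      have : P.natDegree ≤ m := (natDegree_chebyshevMarkov t' m).1
      exact_mod_cast (by omega : P.natDegree < m + 1 + 1))
  obtain ⟨a, r, hr, hPr⟩ := exists_split (t := t) (m := m + 1) (fun k _ => hst k) hPd
  have hx₀s : 1 + s * x₀ = 0 := by
    rw [hx₀, mul_div_cancel₀ _ hs0.ne]
    norm_num
  have hPx : P.eval x₀ = a * ((denom t' m).eval x₀ * (1 + t 0 * x₀)) := by
    rw [hPr, denom_succ']
    simp only [eval_add, eval_mul, eval_C, eval_one, eval_X, hx₀s, zero_mul, add_zero]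
    rfl
  have hdx : (denom t' m).eval x₀ ≠ 0 :=
    eval_denom_ne_zero (fun k _ => hst (k + 1)) hs0.ne
  -- the coefficient of `1 / (1 + s x)`, read off at the pole, is large by the choice of `m`
  have haK : K / ε ≤ |a| := by
    have hgrow := chebyshevMarkov_growth ht'I hx₀1 hy0 hy m
    rw [← hP, hPx] at hgrow
    have hgrow' : 1 + κ * ∑ k ∈ Finset.range m, √(1 - t' k ^ 2)
        ≤ (2 * (a * (1 + t 0 * x₀))) ^ 2 := by
      have h1 : (0 : ℝ) < (denom t' m).eval x₀ ^ 2 := by positivity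
      refine le_of_mul_le_mul_right (hgrow.trans_eq ?_) h1
      ring
    have h2 : (2 * (K / ε) * (1 + t 0 * x₀)) ^ 2 ≤ (2 * (a * (1 + t 0 * x₀))) ^ 2 := by
      linarith
    have h3 : (0 : ℝ) < 4 * (1 + t 0 * x₀) ^ 2 := by positivity
    have h4 : (K / ε) ^ 2 ≤ a ^ 2 := by
      refine le_of_mul_le_mul_right (a := 4 * (1 + t 0 * x₀) ^ 2) ?_ h3
      calc _ = (2 * (K / ε) * (1 + t 0 * x₀)) ^ 2 := by ring
        _ ≤ _ := h2
        _ = _ := by ring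
    have := sq_le_sq.1 h4
    rwa [abs_of_pos (by positivity)] at this
  have hapos : 0 < |a| := lt_of_lt_of_le (by positivity) haK
  have hane : a ≠ 0 := abs_pos.1 hapos
  -- solve the decomposition of `P` for `1 / (1 + s x)`
  obtain ⟨φ, hφ, hφe⟩ := exists_mem_basisSpan_eq_div ht hinj (m + 1) hr
  refine ⟨m + 1, (-a⁻¹) • φ, Submodule.smul_mem _ _ hφ, fun x hx => ?_⟩
  have hb0 := one_add_mul_pos (ht 0) hx
  have hbs := one_add_mul_pos hsI hx
  have hbd := denom_pos ht'I m hx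
  have key : 1 / (1 + s * x) - ((-a⁻¹) • φ) x
      = a⁻¹ * (P.eval x / (denom t' m).eval x * (1 / (1 + t 0 * x) * (1 / (1 + s * x)))) := by
    rw [Pi.smul_apply, hφe x hx, hPr, denom_succ' t m]
    simp only [eval_add, eval_mul, eval_C, eval_one, eval_X, smul_eq_mul]
    change 1 / (1 + s * x) - -a⁻¹ * (r.eval x / ((denom t' m).eval x * (1 + t 0 * x)))
      = a⁻¹ * ((a * ((denom t' m).eval x * (1 + t 0 * x)) + (1 + s * x) * r.eval x)
        / (denom t' m).eval x * (1 / (1 + t 0 * x) * (1 / (1 + s * x))))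
    have e1 := hb0.ne'
    have e2 := hbs.ne'
    have e3 := hbd.ne'
    generalize 1 + s * x = A at e2 ⊢
    generalize 1 + t 0 * x = B at e1 ⊢
    field_simp
    ring
  have hlow : ∀ u ∈ Set.Ioo (-1 : ℝ) 1, 1 - |u| ≤ 1 + u * x := fun u hu => by
    have h1 := neg_abs_le (u * x)
    rw [abs_mul] at h1
    nlinarith [abs_nonneg u, abs_le.2 hx]
  rw [key, abs_mul, abs_mul, abs_div, abs_of_pos hbd, abs_inv,
    abs_of_pos (by positivity : 0 < 1 / (1 + t 0 * x) * (1 / (1 + s * x)))]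
  have h1 : |P.eval x| / (denom t' m).eval x ≤ 1 :=
    (div_le_one hbd).2 (abs_chebyshevMarkov_le ht'I m hx)
  have h2 : 1 / (1 + t 0 * x) * (1 / (1 + s * x)) ≤ K :=
    mul_le_mul (one_div_le_one_div_of_le ha0 (hlow _ (ht 0)))
      (one_div_le_one_div_of_le has (hlow _ hsI)) (by positivity) (by positivity)
  calc |a|⁻¹ * (|P.eval x| / (denom t' m).eval x * (1 / (1 + t 0 * x) * (1 / (1 + s * x))))
      ≤ |a|⁻¹ * (1 * K) := by gcongr
    _ = K / |a| := by ring
    _ ≤ ε := by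
      rw [div_le_iff₀ hapos]
      rwa [div_le_iff₀ hε, mul_comm] at haK

/-- The function `1 / (1 + s x)` as a continuous function on `[-1, 1]`. -/
noncomputable def poleFn {s : ℝ} (hs : s ∈ Set.Ioo (-1 : ℝ) 1) : C(Set.Icc (-1 : ℝ) 1, ℝ) where
  toFun x := 1 / (1 + s * x)
  continuous_toFun := by
    refine continuous_const.div (by fun_prop) fun x => (one_add_mul_pos hs x.2).ne'

/-- The span of all basis functions in `C[-1, 1]`. -/
noncomputable abbrev fullSpan (ht : ∀ k, t k ∈ Set.Ioo (-1 : ℝ) 1) :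
    Submodule ℝ C(Set.Icc (-1 : ℝ) 1, ℝ) :=
  Submodule.span ℝ (Set.range fun k => poleFn (ht k))

theorem exists_mem_fullSpan (ht : ∀ k, t k ∈ Set.Ioo (-1 : ℝ) 1) {m : ℕ} {φ : ℝ → ℝ}
    (hφ : φ ∈ basisSpan t m) : ∃ f ∈ fullSpan ht, ∀ x : Set.Icc (-1 : ℝ) 1, f x = φ x := by
  induction hφ using Submodule.span_induction with
  | mem φ h =>
    obtain ⟨k, rfl⟩ := h
    exact ⟨_, Submodule.subset_span ⟨k, rfl⟩, fun x => rfl⟩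
  | zero => exact ⟨0, Submodule.zero_mem _, fun x => rfl⟩
  | add φ ψ _ _ h1 h2 =>
    obtain ⟨f, hf, hfe⟩ := h1
    obtain ⟨g, hg, hge⟩ := h2
    exact ⟨f + g, Submodule.add_mem _ hf hg, fun x => by simp [hfe, hge]⟩
  | smul a φ _ h =>
    obtain ⟨f, hf, hfe⟩ := h
    exact ⟨a • f, Submodule.smul_mem _ _ hf, fun x => by simp [hfe]⟩

theorem exists_mem_basisSpan (ht : ∀ k, t k ∈ Set.Ioo (-1 : ℝ) 1)
    {f : C(Set.Icc (-1 : ℝ) 1, ℝ)} (hf : f ∈ fullSpan ht) :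
    ∃ m, ∃ φ ∈ basisSpan t m, ∀ x : Set.Icc (-1 : ℝ) 1, f x = φ x := by
  induction hf using Submodule.span_induction with
  | mem f h =>
    obtain ⟨k, rfl⟩ := h
    exact ⟨k + 1, basisFn t k, basisFn_mem_basisSpan t k.lt_succ_self, fun x => rfl⟩
  | zero => exact ⟨0, 0, Submodule.zero_mem _, fun x => rfl⟩
  | add f g _ _ h1 h2 =>
    obtain ⟨m, φ, hφ, hφe⟩ := h1
    obtain ⟨m', ψ, hψ, hψe⟩ := h2
    exact ⟨max m m', φ + ψ, Submodule.add_mem _ (basisSpan_mono t (le_max_left _ _) hφ)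
      (basisSpan_mono t (le_max_right _ _) hψ), fun x => by simp [hφe, hψe]⟩
  | smul a f _ h =>
    obtain ⟨m, φ, hφ, hφe⟩ := h
    exact ⟨m, a • φ, Submodule.smul_mem _ _ hφ, fun x => by simp [hφe]⟩

/-- The multipliers of a subspace `S` of an algebra: the elements `f` with `f * S ⊆ S`. -/
def multipliers {A : Type*} [CommRing A] [Algebra ℝ A] (S : Submodule ℝ A) : Subalgebra ℝ A where
  carrier := {f | ∀ g ∈ S, f * g ∈ S}
  mul_mem' hf hf' g hg := by
    rw [mul_assoc]
    exact hf _ (hf' g hg)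
  add_mem' hf hf' g hg := by
    rw [add_mul]
    exact S.add_mem (hf g hg) (hf' g hg)
  algebraMap_mem' a g hg := by
    rw [← Algebra.smul_def]
    exact S.smul_mem a hg

theorem mul_poleFn {s r : ℝ} (hs : s ∈ Set.Ioo (-1 : ℝ) 1) (hr : r ∈ Set.Ioo (-1 : ℝ) 1)
    (hne : s ≠ r) :
    poleFn hs * poleFn hr = (s / (s - r)) • poleFn hs - (r / (s - r)) • poleFn hr := by
  ext x
  have h1 := (one_add_mul_pos hs x.2).ne'
  have h2 := (one_add_mul_pos hr x.2).ne'
  have h3 := sub_ne_zero.2 hne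
  simp only [poleFn, ContinuousMap.mul_apply, ContinuousMap.coe_mk, ContinuousMap.sub_apply,
    ContinuousMap.smul_apply, smul_eq_mul]
  generalize hA : 1 + s * (x : ℝ) = A at h1 ⊢
  generalize hB : 1 + r * (x : ℝ) = B at h2 ⊢
  field_simp
  linear_combination s * hB - r * hA

/-- The density condition implies density. The closure of the span is stable under multiplication
by one function `1 / (1 + s x)` which separates points; by the Stone–Weierstrass theorem it is
stable under multiplication by all continuous functions, and it contains an invertible one. -/
theorem topologicalClosure_fullSpan (ht : ∀ k, t k ∈ Set.Ioo (-1 : ℝ) 1)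
    (hinj : Function.Injective t) (hd : DensityCondition t) :
    (fullSpan ht).topologicalClosure = ⊤ := by
  set S := (fullSpan ht).topologicalClosure with hS
  have hclosed : IsClosed (S : Set C(Set.Icc (-1 : ℝ) 1, ℝ)) :=
    Submodule.isClosed_topologicalClosure _
  obtain ⟨s, ⟨hs1, hs0⟩, hst⟩ : ∃ s ∈ Set.Ioo (-1 : ℝ) 0, s ∉ Set.range t := by
    by_contra! h
    exact (Cardinal.Real.Ioo_countable_iff.not.2 (by norm_num : ¬ (0 : ℝ) ≤ -1))
      ((Set.countable_range t).mono h)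
  have hst' : ∀ k, s ≠ t k := fun k h => hst ⟨k, h.symm⟩
  have hsI : s ∈ Set.Ioo (-1 : ℝ) 1 := ⟨hs1, hs0.trans one_pos⟩
  have hsS : poleFn hsI ∈ S := by
    rw [hS, ← SetLike.mem_coe, Submodule.topologicalClosure_coe, Metric.mem_closure_iff]
    intro ε hε
    obtain ⟨m, φ, hφ, hφe⟩ := exists_approx_of_density ht hinj hd hs1 hs0 hst' (half_pos hε)
    obtain ⟨f, hf, hfe⟩ := exists_mem_fullSpan ht hφ
    refine ⟨f, hf, lt_of_le_of_lt ?_ (half_lt_self hε)⟩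
    rw [ContinuousMap.dist_le (half_pos hε).le]
    intro x
    rw [Real.dist_eq, hfe]
    exact hφe x x.2
  have hbS : ∀ k, poleFn (ht k) ∈ S := fun k =>
    Submodule.le_topologicalClosure _ (Submodule.subset_span ⟨k, rfl⟩)
  have hsM : poleFn hsI ∈ multipliers S := by
    have h1 : fullSpan ht ≤ S.comap (LinearMap.mulLeft ℝ (poleFn hsI)) := by
      rw [Submodule.span_le]
      rintro _ ⟨k, rfl⟩
      change poleFn hsI * poleFn (ht k) ∈ S
      rw [mul_poleFn hsI (ht k) (hst' k)]
      exact S.sub_mem (S.smul_mem _ hsS) (S.smul_mem _ (hbS k))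
    have h2 : S ≤ S.comap (LinearMap.mulLeft ℝ (poleFn hsI)) :=
      Submodule.topologicalClosure_minimal _ h1
        (hclosed.preimage (continuous_const.mul continuous_id))
    exact h2
  have hMclosed : IsClosed (multipliers S : Set C(Set.Icc (-1 : ℝ) 1, ℝ)) := by
    have : (multipliers S : Set C(Set.Icc (-1 : ℝ) 1, ℝ))
        = ⋂ g ∈ S, {f | f * g ∈ S} := by
      ext f
      simp [multipliers]
    rw [this]
    exact isClosed_biInter fun g _ => hclosed.preimage (continuous_id.mul continuous_const)
  have hMtop : multipliers S = ⊤ := by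
    have hsep : (multipliers S).SeparatesPoints := by
      intro x y hxy
      refine ⟨_, ⟨poleFn hsI, hsM, rfl⟩, fun h => hxy (Subtype.ext ?_)⟩
      have h1 := (one_add_mul_pos hsI x.2).ne'
      have h2 := (one_add_mul_pos hsI y.2).ne'
      simp only [poleFn, ContinuousMap.coe_mk, div_eq_div_iff h1 h2, one_mul] at h
      exact mul_left_cancel₀ hs0.ne (by linarith)
    rw [← ContinuousMap.subalgebra_topologicalClosure_eq_top_of_separatesPoints _ hsep]
    exact le_antisymm (Subalgebra.le_topologicalClosure _)
      (Subalgebra.topologicalClosure_minimal le_rfl hMclosed)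
  rw [eq_top_iff]
  intro f _
  let g : C(Set.Icc (-1 : ℝ) 1, ℝ) := f * ⟨fun x => 1 + t 0 * x, by fun_prop⟩
  have hg : g ∈ multipliers S := hMtop ▸ Algebra.mem_top
  have hfg : f = g * poleFn (ht 0) := by
    ext x
    have h1 := (one_add_mul_pos (ht 0) x.2).ne'
    simp only [g, poleFn, ContinuousMap.mul_apply, ContinuousMap.coe_mk]
    field_simp
  rw [hfg]
  exact hg _ (hbS 0)

theorem exists_approx_of_continuousOn (ht : ∀ k, t k ∈ Set.Ioo (-1 : ℝ) 1)
    (hinj : Function.Injective t) (hd : DensityCondition t) {f : ℝ → ℝ}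
    (hf : ContinuousOn f (Set.Icc (-1 : ℝ) 1)) {ε : ℝ} (hε : 0 < ε) :
    ∃ m, ∃ φ ∈ basisSpan t m, ∀ x ∈ Set.Icc (-1 : ℝ) 1, |f x - φ x| ≤ ε := by
  let F : C(Set.Icc (-1 : ℝ) 1, ℝ) := ⟨_, hf.domRestrict⟩
  have hF : F ∈ (fullSpan ht).topologicalClosure := by
    rw [topologicalClosure_fullSpan ht hinj hd]
    trivial
  rw [← SetLike.mem_coe, Submodule.topologicalClosure_coe, Metric.mem_closure_iff] at hF
  obtain ⟨g, hg, hFg⟩ := hF ε hε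
  obtain ⟨m, φ, hφ, hφe⟩ := exists_mem_basisSpan ht hg
  refine ⟨m, φ, hφ, fun x hx => ?_⟩
  have h1 := (ContinuousMap.dist_apply_le_dist (f := F) (g := g) ⟨x, hx⟩).trans hFg.le
  rwa [Real.dist_eq, hφe] at h1

end Density

/-! ### Lipschitz envelopes of Riemann integrable functions -/

section Envelopes

open MeasureTheory Filter Topology

/-- The smallest `k`-Lipschitz majorant of `f` on `[-1, 1]` (for `f` bounded above there). -/
noncomputable def upperEnvelope (f : ℝ → ℝ) (k : ℕ) (x : ℝ) : ℝ :=
  ⨆ y : Set.Icc (-1 : ℝ) 1, f y - k * |x - y|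

/-- The largest `k`-Lipschitz minorant of `f` on `[-1, 1]` (for `f` bounded below there). -/
noncomputable def lowerEnvelope (f : ℝ → ℝ) (k : ℕ) (x : ℝ) : ℝ :=
  -upperEnvelope (fun y => -f y) k x

instance nonempty_Icc : Nonempty (Set.Icc (-1 : ℝ) 1) := ⟨⟨0, by norm_num⟩⟩

variable {f : ℝ → ℝ} {C : ℝ}

theorem bddAbove_upperEnvelope (hC : ∀ x ∈ Set.Icc (-1 : ℝ) 1, |f x| ≤ C) (k : ℕ) (x : ℝ) :
    BddAbove (Set.range fun y : Set.Icc (-1 : ℝ) 1 => f y - k * |x - y|) := by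
  refine ⟨C, ?_⟩
  rintro _ ⟨y, rfl⟩
  have h1 : 0 ≤ (k : ℝ) * |x - y| := by positivity
  have h2 := (le_abs_self _).trans (hC y y.2)
  simp only
  linarith

theorem le_upperEnvelope (hC : ∀ x ∈ Set.Icc (-1 : ℝ) 1, |f x| ≤ C) (k : ℕ) {x : ℝ}
    (hx : x ∈ Set.Icc (-1 : ℝ) 1) : f x ≤ upperEnvelope f k x := by
  have := le_ciSup (bddAbove_upperEnvelope hC k x) ⟨x, hx⟩
  simpa [upperEnvelope] using this

theorem upperEnvelope_le (hC : ∀ x ∈ Set.Icc (-1 : ℝ) 1, |f x| ≤ C) (k : ℕ) (x : ℝ) :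
    upperEnvelope f k x ≤ C :=
  ciSup_le fun y => by
    have h1 : 0 ≤ (k : ℝ) * |x - y| := by positivity
    have h2 := (le_abs_self _).trans (hC y y.2)
    linarith

theorem continuous_upperEnvelope (hC : ∀ x ∈ Set.Icc (-1 : ℝ) 1, |f x| ≤ C) (k : ℕ) :
    Continuous (upperEnvelope f k) := by
  refine (LipschitzWith.of_le_add_mul (k : NNReal) fun x x' => ciSup_le fun y => ?_).continuous
  have h1 := le_ciSup (bddAbove_upperEnvelope hC k x') y
  have h2 : |x' - y| ≤ |x - y| + |x - x'| := by
    rw [abs_sub_comm x x']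
    linarith [abs_sub_le x' x y]
  have h3 : (k : ℝ) * |x' - y| ≤ k * (|x - y| + |x - x'|) :=
    mul_le_mul_of_nonneg_left h2 k.cast_nonneg
  rw [Real.dist_eq]
  simp only [NNReal.coe_natCast]
  linarith

theorem upperEnvelope_antitone (hC : ∀ x ∈ Set.Icc (-1 : ℝ) 1, |f x| ≤ C) (x : ℝ) :
    Antitone fun k => upperEnvelope f k x := fun k l hkl =>
  ciSup_mono (bddAbove_upperEnvelope hC k x) fun y => by
    have : (k : ℝ) * |x - y| ≤ l * |x - y| :=
      mul_le_mul_of_nonneg_right (by exact_mod_cast hkl) (abs_nonneg _)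
    linarith

/-- At an interior point of `[a, b]` the values outside of `[a, b]` eventually do not contribute to
the envelope. -/
theorem eventually_upperEnvelope_le (hC : ∀ x ∈ Set.Icc (-1 : ℝ) 1, |f x| ≤ C) {a b x M : ℝ}
    (hx : x ∈ Set.Ioo a b) (hM : ∀ y ∈ Set.Icc a b, f y ≤ M) (hCM : -C ≤ M) :
    ∀ᶠ k in atTop, upperEnvelope f k x ≤ M := by
  have hδ : 0 < min (x - a) (b - x) := lt_min (sub_pos.2 hx.1) (sub_pos.2 hx.2)
  filter_upwards [tendsto_natCast_atTop_atTop.eventually_ge_atTop (2 * C / min (x - a) (b - x))]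
    with k hk
  rw [div_le_iff₀ hδ] at hk
  refine ciSup_le fun y => ?_
  by_cases hy : (y : ℝ) ∈ Set.Icc a b
  · have h1 : 0 ≤ (k : ℝ) * |x - y| := by positivity
    linarith [hM y hy]
  · have h1 : min (x - a) (b - x) ≤ |x - y| := by
      rw [Set.mem_Icc, not_and_or, not_le, not_le] at hy
      rcases hy with hy | hy
      · exact (min_le_left _ _).trans (le_trans (by linarith) (le_abs_self _))
      · exact (min_le_right _ _).trans (le_trans (by linarith) (neg_le_abs _))
    have h2 := mul_le_mul_of_nonneg_left h1 (Nat.cast_nonneg (α := ℝ) k)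
    have h3 := (le_abs_self _).trans (hC y y.2)
    linarith

theorem abs_neg_fn_le (hC : ∀ x ∈ Set.Icc (-1 : ℝ) 1, |f x| ≤ C) :
    ∀ x ∈ Set.Icc (-1 : ℝ) 1, |-f x| ≤ C := fun x hx => by rw [abs_neg]; exact hC x hx

theorem lowerEnvelope_le (hC : ∀ x ∈ Set.Icc (-1 : ℝ) 1, |f x| ≤ C) (k : ℕ) {x : ℝ}
    (hx : x ∈ Set.Icc (-1 : ℝ) 1) : lowerEnvelope f k x ≤ f x := by
  have := le_upperEnvelope (abs_neg_fn_le hC) k hx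
  unfold lowerEnvelope
  linarith

theorem continuous_lowerEnvelope (hC : ∀ x ∈ Set.Icc (-1 : ℝ) 1, |f x| ≤ C) (k : ℕ) :
    Continuous (lowerEnvelope f k) := (continuous_upperEnvelope (abs_neg_fn_le hC) k).neg

/-- The gap between the Lipschitz envelopes. -/
noncomputable def envelopeGap (f : ℝ → ℝ) (k : ℕ) (x : ℝ) : ℝ :=
  upperEnvelope f k x - lowerEnvelope f k x

theorem continuous_envelopeGap (hC : ∀ x ∈ Set.Icc (-1 : ℝ) 1, |f x| ≤ C) (k : ℕ) :
    Continuous (envelopeGap f k) :=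
  (continuous_upperEnvelope hC k).sub (continuous_lowerEnvelope hC k)

theorem envelopeGap_nonneg (hC : ∀ x ∈ Set.Icc (-1 : ℝ) 1, |f x| ≤ C) (k : ℕ) {x : ℝ}
    (hx : x ∈ Set.Icc (-1 : ℝ) 1) : 0 ≤ envelopeGap f k x :=
  sub_nonneg.2 ((lowerEnvelope_le hC k hx).trans (le_upperEnvelope hC k hx))

theorem envelopeGap_le (hC : ∀ x ∈ Set.Icc (-1 : ℝ) 1, |f x| ≤ C) (k : ℕ) (x : ℝ) :
    envelopeGap f k x ≤ 2 * C := by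
  have h1 := upperEnvelope_le hC k x
  have h2 := upperEnvelope_le (abs_neg_fn_le hC) k x
  unfold envelopeGap lowerEnvelope
  linarith

theorem envelopeGap_antitone (hC : ∀ x ∈ Set.Icc (-1 : ℝ) 1, |f x| ≤ C) (x : ℝ) :
    Antitone fun k => envelopeGap f k x := fun k l hkl => by
  have h1 := upperEnvelope_antitone hC x hkl
  have h2 := upperEnvelope_antitone (abs_neg_fn_le hC) x hkl
  simp only [envelopeGap, lowerEnvelope] at *
  linarith

theorem bddBelow_envelopeGap (hC : ∀ x ∈ Set.Icc (-1 : ℝ) 1, |f x| ≤ C) {x : ℝ}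
    (hx : x ∈ Set.Icc (-1 : ℝ) 1) : BddBelow (Set.range fun k => envelopeGap f k x) :=
  ⟨0, by rintro _ ⟨k, rfl⟩; exact envelopeGap_nonneg hC k hx⟩

theorem iInf_envelopeGap_le (hC : ∀ x ∈ Set.Icc (-1 : ℝ) 1, |f x| ≤ C) {a b x : ℝ}
    (ha : -1 ≤ a) (hb : b ≤ 1) (hx : x ∈ Set.Ioo a b) :
    ⨅ k, envelopeGap f k x ≤ sSup (f '' Set.Icc a b) - sInf (f '' Set.Icc a b) := by
  have hsub : Set.Icc a b ⊆ Set.Icc (-1 : ℝ) 1 := Set.Icc_subset_Icc ha hb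
  have hxI := Set.Ioo_subset_Icc_self hx
  have hup : BddAbove (f '' Set.Icc a b) :=
    ⟨C, by rintro _ ⟨y, hy, rfl⟩; exact (abs_le.1 (hC y (hsub hy))).2⟩
  have hlo : BddBelow (f '' Set.Icc a b) :=
    ⟨-C, by rintro _ ⟨y, hy, rfl⟩; exact (abs_le.1 (hC y (hsub hy))).1⟩
  have hM : ∀ y ∈ Set.Icc a b, f y ≤ sSup (f '' Set.Icc a b) := fun y hy =>
    le_csSup hup ⟨y, hy, rfl⟩
  have hm : ∀ y ∈ Set.Icc a b, sInf (f '' Set.Icc a b) ≤ f y := fun y hy =>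
    csInf_le hlo ⟨y, hy, rfl⟩
  have hfx := abs_le.1 (hC x (hsub hxI))
  obtain ⟨k, h1, h2⟩ := ((eventually_upperEnvelope_le hC hx hM (by linarith [hM x hxI])).and
    (eventually_upperEnvelope_le (abs_neg_fn_le hC) hx (M := -sInf (f '' Set.Icc a b))
      (fun y hy => neg_le_neg (hm y hy)) (by linarith [hm x hxI]))).exists
  refine (ciInf_le (bddBelow_envelopeGap hC (hsub hxI)) k).trans ?_
  unfold envelopeGap lowerEnvelope
  linarith

/-- The Lipschitz envelopes of a Riemann integrable function converge to the same limit almost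
everywhere: on the intervals of a partition, their gap is in the limit at most the oscillation of
the function, so that its integral is at most the difference of the Darboux sums. -/
theorem IsBoundedRiemannIntegrable.ae_tendsto_envelopeGap (hf : IsBoundedRiemannIntegrable f)
    (hC : ∀ x ∈ Set.Icc (-1 : ℝ) 1, |f x| ≤ C) :
    ∀ᵐ x ∂(volume.restrict (Set.Icc (-1 : ℝ) 1)),
      Tendsto (fun k => envelopeGap f k x) atTop (𝓝 0) := by
  have hC0 : 0 ≤ C := (abs_nonneg _).trans (hC 0 (by norm_num))
  set h : ℝ → ℝ := fun x => ⨅ k, envelopeGap f k x with hdef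
  have hmeas : Measurable h := Measurable.iInf fun k => (continuous_envelopeGap hC k).measurable
  have hnonneg : ∀ x ∈ Set.Icc (-1 : ℝ) 1, 0 ≤ h x := fun x hx =>
    le_ciInf fun k => envelopeGap_nonneg hC k hx
  have hle : ∀ x ∈ Set.Icc (-1 : ℝ) 1, h x ≤ 2 * C := fun x hx =>
    (ciInf_le (bddBelow_envelopeGap hC hx) 0).trans (envelopeGap_le hC 0 x)
  have hint : IntegrableOn h (Set.Icc (-1 : ℝ) 1) :=
    Measure.integrableOn_of_bounded (M := 2 * C) (by simp) hmeas.aestronglyMeasurable (by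
      filter_upwards [ae_restrict_mem measurableSet_Icc] with x hx
      rw [Real.norm_eq_abs, abs_of_nonneg (hnonneg x hx)]
      exact hle x hx)
  have hsmall : ∀ ε > 0, ∫ x in (-1 : ℝ)..1, h x ≤ ε := by
    intro ε hε
    obtain ⟨N, p, hp, hp0, hpN, hsum⟩ := hf.2 ε hε
    have hpge : ∀ i, -1 ≤ p i := fun i => hp0 ▸ hp (Nat.zero_le i)
    have hple : ∀ i < N, p (i + 1) ≤ 1 := fun i hi => hpN ▸ hp (Nat.succ_le_of_lt hi)
    have hii : ∀ i < N, IntervalIntegrable h volume (p i) (p (i + 1)) := fun i hi =>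
      (intervalIntegrable_iff_integrableOn_Icc_of_le (hp i.le_succ)).2
        (hint.mono_set (Set.Icc_subset_Icc (hpge i) (hple i hi)))
    have hadj := intervalIntegral.sum_integral_adjacent_intervals hii
    rw [hp0, hpN] at hadj
    rw [← hadj]
    refine le_trans (Finset.sum_le_sum fun i hi => ?_) hsum.le
    have hiN := Finset.mem_range.1 hi
    refine (intervalIntegral.integral_mono_on_of_le_Ioo (hp i.le_succ) (hii i hiN)
      intervalIntegrable_const fun x hx =>
        iInf_envelopeGap_le hC (hpge i) (hple i hiN) hx).trans_eq ?_
    rw [intervalIntegral.integral_const, smul_eq_mul, mul_comm]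
  have hzero : h =ᵐ[volume.restrict (Set.Icc (-1 : ℝ) 1)] 0 := by
    have hnn : 0 ≤ᵐ[volume.restrict (Set.Icc (-1 : ℝ) 1)] h := by
      filter_upwards [ae_restrict_mem measurableSet_Icc] with x hx
      exact hnonneg x hx
    rw [← setIntegral_eq_zero_iff_of_nonneg_ae hnn hint]
    refine le_antisymm (le_of_forall_pos_le_add fun ε hε => ?_) (integral_nonneg_of_ae hnn)
    rw [integral_Icc_eq_integral_Ioc, ← intervalIntegral.integral_of_le (by norm_num), zero_add]
    exact hsmall ε hε
  filter_upwards [hzero, ae_restrict_mem measurableSet_Icc] with x hx hm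
  have h1 := tendsto_atTop_ciInf (envelopeGap_antitone hC x) (bddBelow_envelopeGap hC hm)
  rwa [show ⨅ k, envelopeGap f k x = 0 from hx] at h1

end Envelopes

/-! ### Convergence of positive formulas -/

section Convergence

open MeasureTheory Filter Topology

variable {w : ℝ → ℝ} {t : ℕ → ℝ}

theorem tendsto_quadError_of_continuousOn (hw : IsWeight w) (ht : ∀ k, t k ∈ Set.Ioo (-1 : ℝ) 1)
    (hinj : Function.Injective t) (hd : DensityCondition t) {m : ℕ → ℕ} (hm : ∀ n, n ≤ m n)
    {x β : (n : ℕ) → Fin n → ℝ} (h : ∀ n ≥ 1, IsPositiveExact w t (m n) (x n) (β n))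
    {f : ℝ → ℝ} (hf : ContinuousOn f (Set.Icc (-1 : ℝ) 1)) :
    Tendsto (fun n => quadError w f (x n) (β n)) atTop (𝓝 0) := by
  have hM := errorConst_pos hw ht
  rw [Metric.tendsto_atTop]
  intro ε hε
  obtain ⟨N, φ, hφ, hφe⟩ := exists_approx_of_continuousOn ht hinj hd hf
    (ε := ε / 2 / errorConst w t) (by positivity)
  refine ⟨max N 1, fun n hn => ?_⟩
  have hn1 : 1 ≤ n := (le_max_right _ _).trans hn
  have hNn : N ≤ m n := ((le_max_left _ _).trans hn).trans (hm n)
  have h1 := (h n hn1).abs_quadError_le hw ht (hn1.trans (hm n)) hf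
    (basisSpan_mono t hNn hφ) hφe
  rw [mul_div_cancel₀ _ hM.ne'] at h1
  rw [Real.dist_eq, sub_zero]
  linarith

theorem IsBoundedRiemannIntegrable.aestronglyMeasurable {f : ℝ → ℝ}
    (hf : IsBoundedRiemannIntegrable f) :
    AEStronglyMeasurable f (volume.restrict (Set.Icc (-1 : ℝ) 1)) := by
  obtain ⟨C, hC⟩ := hf.1
  refine aestronglyMeasurable_of_tendsto_ae atTop (f := upperEnvelope f)
    (fun k => (continuous_upperEnvelope hC k).aestronglyMeasurable) ?_
  filter_upwards [hf.ae_tendsto_envelopeGap hC, ae_restrict_mem measurableSet_Icc] with x hx hm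
  have h1 := hx.const_add (f x)
  rw [add_zero] at h1
  refine tendsto_of_tendsto_of_tendsto_of_le_of_le tendsto_const_nhds h1
    (fun k => le_upperEnvelope hC k hm) fun k => ?_
  have := lowerEnvelope_le hC k hm
  simp only [envelopeGap]
  linarith

theorem IsBoundedRiemannIntegrable.intervalIntegrable_mul {f : ℝ → ℝ}
    (hf : IsBoundedRiemannIntegrable f) (hw : IsWeight w) :
    IntervalIntegrable (fun x => f x * w x) volume (-1) 1 := by
  obtain ⟨C, hC⟩ := hf.1
  refine (intervalIntegrable_iff_integrableOn_Icc_of_le (by norm_num)).2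
    (hw.integrableOn.bdd_mul (c := C) hf.aestronglyMeasurable ?_)
  filter_upwards [ae_restrict_mem measurableSet_Icc] with x hx
  exact hC x hx

theorem IsBoundedRiemannIntegrable.tendsto_integral_envelopeGap {f : ℝ → ℝ} {C : ℝ}
    (hf : IsBoundedRiemannIntegrable f) (hC : ∀ x ∈ Set.Icc (-1 : ℝ) 1, |f x| ≤ C)
    (hw : IsWeight w) :
    Tendsto (fun k => ∫ x in (-1 : ℝ)..1, envelopeGap f k x * w x) atTop (𝓝 0) := by
  have h0 : ∫ x in Set.Icc (-1 : ℝ) 1, (0 : ℝ) = 0 := by simp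
  simp only [intervalIntegral.integral_of_le (by norm_num : (-1 : ℝ) ≤ 1),
    ← integral_Icc_eq_integral_Ioc]
  rw [← h0]
  refine tendsto_integral_of_dominated_convergence (fun x => 2 * C * w x) (fun k => ?_)
    (hw.integrableOn.const_mul _) (fun k => ?_) ?_
  · exact (continuous_envelopeGap hC k).aestronglyMeasurable.mul
      hw.integrableOn.aestronglyMeasurable
  · filter_upwards [hw.pos, ae_restrict_mem measurableSet_Icc] with x hx hm
    rw [Real.norm_eq_abs, abs_mul, abs_of_pos hx, abs_of_nonneg (envelopeGap_nonneg hC k hm)]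
    exact mul_le_mul_of_nonneg_right (envelopeGap_le hC k x) hx.le
  · filter_upwards [hf.ae_tendsto_envelopeGap hC] with x hx
    simpa using hx.mul_const (w x)

/-- Riemann integrable functions are squeezed between their continuous envelopes, on which the
formulas converge; here the weights have to be nonnegative. -/
theorem tendsto_quadError_of_riemannIntegrable (hw : IsWeight w)
    (ht : ∀ k, t k ∈ Set.Ioo (-1 : ℝ) 1) (hinj : Function.Injective t) (hd : DensityCondition t)
    {m : ℕ → ℕ} (hm : ∀ n, n ≤ m n) {x β : (n : ℕ) → Fin n → ℝ}
    (h : ∀ n ≥ 1, IsPositiveExact w t (m n) (x n) (β n)) {f : ℝ → ℝ}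
    (hf : IsBoundedRiemannIntegrable f) :
    Tendsto (fun n => quadError w f (x n) (β n)) atTop (𝓝 0) := by
  obtain ⟨C, hC⟩ := hf.1
  rw [Metric.tendsto_atTop]
  intro ε hε
  obtain ⟨k, hk⟩ := ((hf.tendsto_integral_envelopeGap hC hw).eventually_lt_const
    (half_pos hε)).exists
  have hUc := (continuous_upperEnvelope hC k).continuousOn (s := Set.Icc (-1 : ℝ) 1)
  have hLc := (continuous_lowerEnvelope hC k).continuousOn (s := Set.Icc (-1 : ℝ) 1)
  have hUi := hw.intervalIntegrable_mul hUc
  have hLi := hw.intervalIntegrable_mul hLc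
  have hfi := hf.intervalIntegrable_mul hw
  obtain ⟨N₁, hN₁⟩ := (Metric.tendsto_atTop.1
    (tendsto_quadError_of_continuousOn hw ht hinj hd hm h hUc)) (ε / 2) (half_pos hε)
  obtain ⟨N₂, hN₂⟩ := (Metric.tendsto_atTop.1
    (tendsto_quadError_of_continuousOn hw ht hinj hd hm h hLc)) (ε / 2) (half_pos hε)
  refine ⟨max 1 (max N₁ N₂), fun n hn => ?_⟩
  have hpos := h n ((le_max_left _ _).trans hn)
  have h1 := hN₁ n (((le_max_left _ _).trans (le_max_right _ _)).trans hn)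
  have h2 := hN₂ n (((le_max_right _ _).trans (le_max_right _ _)).trans hn)
  rw [Real.dist_eq, sub_zero, abs_lt] at h1 h2 ⊢
  have hfU := hw.integral_mono hfi hUi fun y hy => le_upperEnvelope hC k hy
  have hLf := hw.integral_mono hLi hfi fun y hy => lowerEnvelope_le hC k hy
  have hQU : ∑ j, β n j * f (x n j) ≤ ∑ j, β n j * upperEnvelope f k (x n j) :=
    Finset.sum_le_sum fun j _ =>
      mul_le_mul_of_nonneg_left (le_upperEnvelope hC k (hpos.mem_Icc j)) (hpos.nonneg j)
  have hQL : ∑ j, β n j * lowerEnvelope f k (x n j) ≤ ∑ j, β n j * f (x n j) :=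
    Finset.sum_le_sum fun j _ =>
      mul_le_mul_of_nonneg_left (lowerEnvelope_le hC k (hpos.mem_Icc j)) (hpos.nonneg j)
  have hgap : ∫ y in (-1 : ℝ)..1, envelopeGap f k y * w y
      = (∫ y in (-1 : ℝ)..1, upperEnvelope f k y * w y)
        - ∫ y in (-1 : ℝ)..1, lowerEnvelope f k y * w y := by
    rw [← intervalIntegral.integral_sub hUi hLi]
    simp only [envelopeGap, sub_mul]
  rw [hgap] at hk
  unfold quadError at *
  constructor <;> linarith [h1.1, h1.2, h2.1, h2.2]

end Convergence

end RationalQuadrature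

theorem theorem5 (w : ℝ → ℝ) (t : ℕ → ℝ)
    (hw_int : MeasureTheory.IntegrableOn w (Set.Icc (-1 : ℝ) 1))
    (hw_pos : ∀ᵐ x ∂(MeasureTheory.volume.restrict (Set.Icc (-1 : ℝ) 1)), 0 < w x)
    (ht_mem : ∀ k, t k ∈ Set.Ioo (-1 : ℝ) 1)
    (ht_inj : Function.Injective t) :
    -- orthogonal quadrature
    (t 0 = 0 →
      (∀ n ≥ 1, ∃ x β : Fin n → ℝ, RationalQuadrature.IsOrthogonalQuadrature w t n x β) ∧
      (∃ M > 0, ∀ n ≥ 1, ∀ x β : Fin n → ℝ,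
        RationalQuadrature.IsOrthogonalQuadrature w t n x β →
        ∀ f φ : ℝ → ℝ, ContinuousOn f (Set.Icc (-1 : ℝ) 1) →
          RationalQuadrature.IsBestApprox t (n + 1) f φ →
          |RationalQuadrature.quadError w f x β| ≤ M * RationalQuadrature.supNorm (f - φ)) ∧
      (RationalQuadrature.DensityCondition t →
        ∀ x β : (n : ℕ) → Fin n → ℝ,
          (∀ n ≥ 1, RationalQuadrature.IsOrthogonalQuadrature w t n (x n) (β n)) →
          ∀ f : ℝ → ℝ, RationalQuadrature.IsBoundedRiemannIntegrable f →
            Filter.Tendsto (fun n => RationalQuadrature.quadError w f (x n) (β n))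
              Filter.atTop (nhds 0))) ∧
    -- Gaussian quadrature
    ((∀ n ≥ 1, ∃ x β : Fin n → ℝ, RationalQuadrature.IsGaussianQuadrature w t n x β) ∧
      (∃ M > 0, ∀ n ≥ 1, ∀ x β : Fin n → ℝ,
        RationalQuadrature.IsGaussianQuadrature w t n x β →
        ∀ f φ : ℝ → ℝ, ContinuousOn f (Set.Icc (-1 : ℝ) 1) →
          RationalQuadrature.IsBestApprox t (2 * n) f φ →
          |RationalQuadrature.quadError w f x β| ≤ M * RationalQuadrature.supNorm (f - φ)) ∧
      (RationalQuadrature.DensityCondition t →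
        ∀ x β : (n : ℕ) → Fin n → ℝ,
          (∀ n ≥ 1, RationalQuadrature.IsGaussianQuadrature w t n (x n) (β n)) →
          ∀ f : ℝ → ℝ, RationalQuadrature.IsBoundedRiemannIntegrable f →
            Filter.Tendsto (fun n => RationalQuadrature.quadError w f (x n) (β n))
              Filter.atTop (nhds 0))) := by
  have hw : RationalQuadrature.IsWeight w := ⟨hw_int, hw_pos⟩
  have hM := RationalQuadrature.errorConst_pos hw ht_mem
  refine ⟨fun h0 => ⟨fun n _ => ?_, ⟨_, hM, fun n hn x β h f φ hf hφ => ?_⟩,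
      fun hd x β h f hf => ?_⟩,
    fun n _ => ?_, ⟨_, hM, fun n hn x β h f φ hf hφ => ?_⟩, fun hd x β h f hf => ?_⟩
  · exact RationalQuadrature.exists_isOrthogonalQuadrature hw ht_mem ht_inj n
  · exact (h.isPositiveExact hw ht_mem ht_inj h0 hn).abs_quadError_le_supNorm hw ht_mem
      (by omega) hf hφ.1
  · exact RationalQuadrature.tendsto_quadError_of_riemannIntegrable hw ht_mem ht_inj hd
      (m := fun n => n + 1) (fun n => n.le_succ)
      (fun n hn => (h n hn).isPositiveExact hw ht_mem ht_inj h0 hn) hf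
  · exact RationalQuadrature.exists_isGaussianQuadrature hw ht_mem ht_inj n
  · exact (h.isPositiveExact hw ht_mem ht_inj).abs_quadError_le_supNorm hw ht_mem
      (by omega) hf hφ.1
  · exact RationalQuadrature.tendsto_quadError_of_riemannIntegrable hw ht_mem ht_inj hd
      (m := fun n => 2 * n) (fun n => by omega)
      (fun n hn => (h n hn).isPositiveExact hw ht_mem ht_inj) hf
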